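/- Let $r\ge 1$ be the number of receive antennas, $K\ge r$ the number of users and $P>0$ the transmit power (unit noise power; $\log$ is the natural logarithm). The channel vectors $\mathbf h_1,\dots,\mathbf h_K\in\mathbb C^r$ are random; the real and imaginary parts of all their entries are independent centred Gaussian variables with common variance $\sigma^2$. The multi-threshold SIC channel access algorithm with arbitrary real thresholds $u^{(1)},\dots,u^{(r)}$ runs through iterations $l=1,\dots,r$. In iteration $l$, every user $i$ not scheduled before computes $\|\mathbf V^{(l-1)}\mathbf h_i\|^2$, where the rows of $\mathbf V^{(l-1)}$ form an orthonormal basis of the orthogonal complement of the span of the channel vectors of the users scheduled in iterations $1,\dots,l-1$ (so $\mathbf V^{(0)}=I$). The users with $\|\mathbf V^{(l-1)}\mathbf h_i\|^2>u^{(l)}$ contend, or all remaining users if there is none, and collision resolution schedules the contender for which $\|\mathbf V^{(l-1)}\mathbf h_i\|^2$ is largest (ties are broken by any measurable rule). Let $\mathbf h_{i_l}$ be the channel vector of the user scheduled in iteration $l$. With ZF-SIC decoding the stream of iteration $l$ has rate $\log(1+P\|\mathbf V^{(l-1)}\mathbf h_{i_l}\|^2)$, and the expected sum capacity is $$C_{av}=\mathbb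 E\Big[\sum_{l=1}^r\log\big(1+P\|\mathbf V^{(l-1)}\mathbf h_{i_l}\|^2\big)\Big].$$ For integers $n,d\ge1$ let $$a_{\{n,d\}}=\frac2n\,\Gamma(d)\,e^{q}\,q^{1-d},\qquad b_{\{n,d\}}=2q,\qquad q=Q^{-1}\big(d,\tfrac1n\big),$$ where $Q(d,x)=\Gamma(d)^{-1}\int_x^\infty t^{d-1}e^{-t}\,dt$ and $Q^{-1}(d,\cdot)$ is its inverse with respect to $x\in[0,\infty)$, and let $\gamma$ be Euler's constant. Then the sum rate is integrable and $$C_{av}\le\sum_{l=1}^{r}\log\Big(1+P\big(b_{\{K,r-l+1\}}+\gamma\,a_{\{K,r-l+1\}}\big)\Big)$$ holds in each of the following two cases: (i) $\sigma^2=1/2$, for every $K\ge r$; (ii) $\sigma^2=1$ (so that $\|\mathbf h_i\|^2$ has exactly the $\chi^2_{2r}$ distribution), for every $K\ge \max(K_0,r)$, where $K_0$ depends only on $r$ and $P$. -/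

import Mathlib

open MeasureTheory ProbabilityTheory

namespace SICAccess

noncomputable section

/-- The upper incomplete Gamma function `Γ(s, x) = ∫_x^∞ t^(s-1) e^(-t) dt`. -/
def upperGamma (s x : ℝ) : ℝ :=
  ∫ t in Set.Ioi x, t ^ (s - 1) * Real.exp (-t)

/-- The regularized upper incomplete Gamma function `Q(s, x) = Γ(s, x) / Γ(s)`. -/
def regGammaQ (s x : ℝ) : ℝ :=
  upperGamma s x / Real.Gamma s

/-- The inverse `Q⁻¹(s, p)` of `x ↦ Q(s, x)` on `[0, ∞)`. -/
def regGammaQInv (s p : ℝ) : ℝ :=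
  Function.invFunOn (regGammaQ s) (Set.Ici 0) p

/-- The scale constant
`a_{n,d} = (2/n) Γ(d) exp(Q⁻¹(d, 1/n)) Q⁻¹(d, 1/n)^(1-d)` of the maximum of `n`
independent chi-squared variables with `2 d` degrees of freedom. -/
def aConst (n d : ℕ) : ℝ :=
  2 / (n : ℝ) * Real.Gamma d * Real.exp (regGammaQInv d (1 / (n : ℝ)))
    * regGammaQInv d (1 / (n : ℝ)) ^ (1 - (d : ℝ))

/-- The location constant `b_{n,d} = 2 Q⁻¹(d, 1/n)`: the `1 - 1/n` quantile of the
chi-squared distribution with `2 d` degrees of freedom. -/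
def bConst (n d : ℕ) : ℝ :=
  2 * regGammaQInv d (1 / (n : ℝ))

/-- The real (`false`) or imaginary (`true`) part of the entry at antenna `p.2.1` of the
channel vector of user `p.1`. -/
def component {Ω : Type*} {r K : ℕ} (h : Fin K → Ω → EuclideanSpace ℂ (Fin r))
    (p : Fin K × Fin r × Bool) (ω : Ω) : ℝ :=
  if p.2.2 then (h p.1 ω p.2.1).im else (h p.1 ω p.2.1).re

/-- The channel model: the real and imaginary parts of all entries of all channel vectors are
independent centred Gaussian variables of variance `v`. -/
structure IsGaussianChannel {Ω : Type*} [MeasurableSpace Ω] (μ : Measure Ω) {r K : ℕ}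
    (v : NNReal) (h : Fin K → Ω → EuclideanSpace ℂ (Fin r)) : Prop where
  hasLaw : ∀ p : Fin K × Fin r × Bool, HasLaw (component h p) (gaussianReal 0 v) μ
  indep : iIndepFun (component h) μ

/-- The power gain `‖V x‖²` of the channel vector `x` after zero forcing against the vectors
in `S`. Here the rows of `V` form an orthonormal basis of the orthogonal complement of the
span of `S`, so `‖V x‖` is the norm of the orthogonal projection of `x` to it. -/
def zfGain {r : ℕ} (S : Set (EuclideanSpace ℂ (Fin r))) (x : EuclideanSpace ℂ (Fin r)) : ℝ :=
  ‖(Submodule.span ℂ S)ᗮ.starProjection x‖ ^ 2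

/-- The channel vectors announced before iteration `l`, when `sel m` is the user scheduled in
iteration `m` (iterations are numbered from `0`). -/
def announced {r K : ℕ} (h : Fin K → EuclideanSpace ℂ (Fin r)) (sel : Fin r → Fin K)
    (l : Fin r) : Set (EuclideanSpace ℂ (Fin r)) :=
  (fun m => h (sel m)) '' Set.Iio l

/-- The users not scheduled before iteration `l`. -/
def remaining {r K : ℕ} (sel : Fin r → Fin K) (l : Fin r) : Set (Fin K) :=
  {i | ∀ m < l, sel m ≠ i}

/-- The remaining users whose projected gain exceeds the threshold `u l` of iteration `l`. -/
def exceeding {r K : ℕ} (u : Fin r → ℝ) (h : Fin K → EuclideanSpace ℂ (Fin r))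
    (sel : Fin r → Fin K) (l : Fin r) : Set (Fin K) :=
  {i | i ∈ remaining sel l ∧ u l < zfGain (announced h sel l) (h i)}

open Classical in
/-- The users among which the collision resolution of iteration `l` looks for the strongest
one: those above the threshold, or all remaining users if nobody is above it. -/
def contenders {r K : ℕ} (u : Fin r → ℝ) (h : Fin K → EuclideanSpace ℂ (Fin r))
    (sel : Fin r → Fin K) (l : Fin r) : Set (Fin K) :=
  if (exceeding u h sel l).Nonempty then exceeding u h sel l else remaining sel l

/-- `sel` is an outcome of the multi-threshold SIC channel access algorithm with thresholds `u`
on the channel vectors `h`: in every iteration the scheduled user is a contender whose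
projection to the null space of the announced channel vectors is strongest. -/
def IsSICRun {r K : ℕ} (u : Fin r → ℝ) (h : Fin K → EuclideanSpace ℂ (Fin r))
    (sel : Fin r → Fin K) : Prop :=
  ∀ l : Fin r, sel l ∈ contenders u h sel l ∧
    ∀ i ∈ contenders u h sel l,
      zfGain (announced h sel l) (h i) ≤ zfGain (announced h sel l) (h (sel l))

/-- The sum rate of ZF-SIC decoding with transmit power `P` per user and unit noise power. The
stream of iteration `l` is decoded after those of the later iterations were subtracted, and
with those of the earlier iterations nulled by projection. -/
def sumRate {r K : ℕ} (P : ℝ) (h : Fin K → EuclideanSpace ℂ (Fin r))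
    (sel : Fin r → Fin K) : ℝ :=
  ∑ l : Fin r, Real.log (1 + P * zfGain (announced h sel l) (h (sel l)))

/-- The expected sum capacity. -/
def expectedSumCapacity {Ω : Type*} [MeasurableSpace Ω] (μ : Measure Ω) {r K : ℕ} (P : ℝ)
    (h : Fin K → Ω → EuclideanSpace ℂ (Fin r)) (sel : Ω → Fin r → Fin K) : ℝ :=
  ∫ ω, sumRate P (fun i => h i ω) (sel ω) ∂μ

/-- The right-hand side `∑_{l=1}^r log (1 + P (b_{K,r-l+1} + γ a_{K,r-l+1}))`. -/
def upperBound (P : ℝ) (r K : ℕ) : ℝ :=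
  ∑ l ∈ Finset.Icc 1 r,
    Real.log (1 + P * (bConst K (r - l + 1)
      + Real.eulerMascheroniConstant * aConst K (r - l + 1)))

end

end SICAccess

namespace SICAccess

open Filter Topology Set

/-! The thresholds only decide who contends: the strongest contender is always the strongest
remaining user, so the schedule is greedy and the bound does not depend on `u`.

The core is a stochastic domination. Number iterations from 0 and let `v` be the variance of a real
component. The gain `Z` of iteration `l` satisfies `P(Z ≤ t) ≥ (1 - Q(r - l, t / (2v)))^K`, as if it
were below the maximum of `K` independent Gamma variables of shape `r - l`, scaled by `2v`. Fix the
earlier scheduled users and their vectors. The other users are then independent and conditioned only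
on having lost the earlier rounds, that is, on upper bounds for their projections to larger null
spaces. The component of an isotropic Gaussian vector in the current null space is independent of
the rest, and the earlier bounds become harder to satisfy as its norm grows. By Chebyshev's
association inequality, having lost can only make a small gain more likely
(`measure_pi_greedyPrefix_mul_le`). Summing over the possible prefixes of the schedule gives
`measure_zfGain_sel_le_ge`.

For the mean, the increasing hazard rate of the Gamma law puts its log-tail below the tangent at the
quantile `q` (`poissonTail_le_exp`). This replaces the Gamma tail by a shifted exponential one of
rate `2/a`, and the maximum of `K` such variables has mean `q + (H_K - log K) a/2`, where `H_K` is
the harmonic number.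

It remains to apply Jensen's inequality to `log (1 + P z)`. For variance 1/2 the mean is at most `q
+ a/2`, which is below `2q + γa` because `γ > 1/2`. For variance 1 the bound on the mean is `2q +
(H_K - log K) a`, which overshoots `2q + γa` by at most `a/K`. The overshoot is absorbed by the gap
in Jensen's inequality: `Z` falls below `2q`, hence `γa` below the target, with probability at least
1/4, and for large `K` this outweighs `a/K`. -/

/-! ### Gamma tails of integer shape and their quantiles -/

/-- The closed form `e^(-x) ∑_{k<d} x^k / k!` of `Q(d, x)` at a natural number `d`. -/
noncomputable def poissonTail (d : ℕ) (x : ℝ) : ℝ :=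
  Real.exp (-x) * ∑ k ∈ Finset.range d, x ^ k / (k.factorial : ℝ)

/-- The density of the Gamma distribution of integer shape `d` and rate one. -/
noncomputable def gammaDensity (d : ℕ) (x : ℝ) : ℝ :=
  Real.exp (-x) * (x ^ (d - 1) / ((d - 1).factorial : ℝ))

lemma hasDerivAt_poissonTail {d : ℕ} (hd : 1 ≤ d) (x : ℝ) :
    HasDerivAt (poissonTail d) (-gammaDensity d x) x := by
  obtain ⟨m, rfl⟩ : ∃ m, d = m + 1 := ⟨d - 1, by omega⟩
  clear hd
  induction m with
  | zero =>
    have h : HasDerivAt (fun x : ℝ => Real.exp (-x)) (Real.exp (-x) * (-1)) x :=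
      (hasDerivAt_neg x).exp
    have hfun : poissonTail (0 + 1) = fun x : ℝ => Real.exp (-x) := by
      ext y; simp [poissonTail]
    rw [hfun]
    exact h.congr_deriv (by simp [gammaDensity])
  | succ m ih =>
    have h1 : HasDerivAt (fun x : ℝ => Real.exp (-x)) (Real.exp (-x) * (-1)) x :=
      (hasDerivAt_neg x).exp
    have h2 : HasDerivAt (fun x : ℝ => x ^ (m + 1) / ((m + 1).factorial : ℝ))
        (((m + 1 : ℕ) : ℝ) * x ^ m / ((m + 1).factorial : ℝ)) x := by
      simpa using (hasDerivAt_pow (m + 1) x).div_const _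
    have h3 := ih.add (h1.mul h2)
    have hfun : poissonTail (m + 1 + 1) = poissonTail (m + 1) +
        (fun x : ℝ => Real.exp (-x)) * fun x : ℝ => x ^ (m + 1) / ((m + 1).factorial : ℝ) := by
      ext y
      simp only [poissonTail, Pi.add_apply, Pi.mul_apply]
      rw [Finset.sum_range_succ _ (m + 1), mul_add]
    rw [hfun]
    refine h3.congr_deriv ?_
    simp only [gammaDensity, Nat.add_sub_cancel, Nat.factorial_succ m]
    have : (m.factorial : ℝ) ≠ 0 := by positivity
    have h4 : ((m : ℝ) + 1) ≠ 0 := by positivity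
    push_cast
    field_simp
    ring

lemma poissonTail_zero {d : ℕ} (hd : 1 ≤ d) : poissonTail d 0 = 1 := by
  obtain ⟨m, rfl⟩ : ∃ m, d = m + 1 := ⟨d - 1, by omega⟩
  simp [poissonTail, Finset.sum_range_succ']

lemma tendsto_poissonTail (d : ℕ) : Tendsto (poissonTail d) atTop (𝓝 0) := by
  have h : ∀ k ∈ Finset.range d,
      Tendsto (fun x : ℝ => Real.exp (-x) * (x ^ k / (k.factorial : ℝ))) atTop (𝓝 0) := by
    intro k _
    have := (Real.tendsto_pow_mul_exp_neg_atTop_nhds_zero k).div_const (k.factorial : ℝ)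
    rw [zero_div] at this
    refine this.congr fun x => ?_
    ring
  have := tendsto_finsetSum _ h
  simp only [Finset.sum_const_zero] at this
  refine this.congr fun x => ?_
  rw [poissonTail, Finset.mul_sum]

lemma gammaDensity_nonneg (d : ℕ) {x : ℝ} (hx : 0 ≤ x) : 0 ≤ gammaDensity d x := by
  unfold gammaDensity; positivity

lemma poissonTail_pos {d : ℕ} (hd : 1 ≤ d) {x : ℝ} (hx : 0 ≤ x) : 0 < poissonTail d x := by
  obtain ⟨m, rfl⟩ : ∃ m, d = m + 1 := ⟨d - 1, by omega⟩
  unfold poissonTail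
  rw [Finset.sum_range_succ']
  have : 0 ≤ ∑ k ∈ Finset.range m, x ^ (k + 1) / ((k + 1).factorial : ℝ) :=
    Finset.sum_nonneg fun k _ => by positivity
  simp only [pow_zero, Nat.factorial_zero, Nat.cast_one, div_one]
  positivity

lemma antitoneOn_poissonTail {d : ℕ} (hd : 1 ≤ d) : AntitoneOn (poissonTail d) (Ici 0) := by
  refine antitoneOn_of_hasDerivWithinAt_nonpos (convex_Ici 0)
    (fun x _ => (hasDerivAt_poissonTail hd x).continuousAt.continuousWithinAt)
    (fun x _ => (hasDerivAt_poissonTail hd x).hasDerivWithinAt) ?_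
  intro x hx
  rw [interior_Ici] at hx
  exact neg_nonpos.2 (gammaDensity_nonneg d (le_of_lt hx))

lemma poissonTail_le_one {d : ℕ} (hd : 1 ≤ d) {x : ℝ} (hx : 0 ≤ x) : poissonTail d x ≤ 1 := by
  rw [← poissonTail_zero hd]
  exact antitoneOn_poissonTail hd self_mem_Ici hx hx

/-- The density is the last summand of the tail. Thus the hazard rate is at most 1, which later
gives `2 ≤ aConst n d`. -/
lemma gammaDensity_le_poissonTail {d : ℕ} (hd : 1 ≤ d) {x : ℝ} (hx : 0 ≤ x) :
    gammaDensity d x ≤ poissonTail d x := by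
  unfold gammaDensity poissonTail
  gcongr
  exact Finset.single_le_sum (f := fun k => x ^ k / (k.factorial : ℝ))
    (fun k _ => by positivity) (Finset.mem_range.2 (Nat.sub_lt hd one_pos))

lemma regGammaQ_eq_poissonTail {d : ℕ} (hd : 1 ≤ d) {x : ℝ} (hx : 0 ≤ x) :
    regGammaQ d x = poissonTail d x := by
  have h1 : ∫ t in Ioi x, -gammaDensity d t = 0 - poissonTail d x :=
    integral_Ioi_of_hasDerivAt_of_nonpos' (fun t _ => hasDerivAt_poissonTail hd t)
      (fun t ht => neg_nonpos.2 (gammaDensity_nonneg d (hx.trans (le_of_lt ht))))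
      (tendsto_poissonTail d)
  have hG : Real.Gamma d = ((d - 1).factorial : ℝ) := by
    rw [← Real.Gamma_nat_eq_factorial (d - 1), Nat.cast_sub hd, Nat.cast_one, sub_add_cancel]
  have h2 : upperGamma d x = ((d - 1).factorial : ℝ) * ∫ t in Ioi x, gammaDensity d t := by
    unfold upperGamma
    rw [← integral_const_mul]
    refine setIntegral_congr_fun measurableSet_Ioi fun t ht => ?_
    have ht0 : 0 < t := lt_of_le_of_lt hx ht
    have : t ^ ((d : ℝ) - 1) = t ^ (d - 1) := by
      rw [← Real.rpow_natCast, Nat.cast_sub hd, Nat.cast_one]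
    have h3 : ((d - 1).factorial : ℝ) ≠ 0 := by positivity
    simp only [this, gammaDensity]
    field_simp
  rw [integral_neg] at h1
  have h3 : ((d - 1).factorial : ℝ) ≠ 0 := by positivity
  rw [regGammaQ, h2, hG, mul_div_cancel_left₀ _ h3]
  linarith

/-- The quantile `Q⁻¹(d, 1/n)` is a nonnegative solution of `Q(d, q) = 1/n`. -/
lemma regGammaQInv_spec {d n : ℕ} (hd : 1 ≤ d) (hn : 1 ≤ n) :
    0 ≤ regGammaQInv d (1 / (n : ℝ)) ∧
      poissonTail d (regGammaQInv d (1 / (n : ℝ))) = 1 / (n : ℝ) := by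
  have hn0 : (0 : ℝ) < 1 / n := by positivity
  have hn1 : 1 / (n : ℝ) ≤ 1 := by
    rw [div_le_one (by positivity)]; exact_mod_cast hn
  have hex : ∃ x ∈ Ici (0 : ℝ), regGammaQ d x = 1 / (n : ℝ) := by
    obtain ⟨M, hM, hM0⟩ := (((tendsto_poissonTail d).eventually (gt_mem_nhds hn0)).and
      (eventually_ge_atTop 0)).exists
    have hc : ContinuousOn (poissonTail d) (Icc 0 M) :=
      fun x _ => (hasDerivAt_poissonTail hd x).continuousAt.continuousWithinAt
    obtain ⟨x, hx, hxe⟩ := intermediate_value_Icc' hM0 hc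
      ⟨hM.le, by rw [poissonTail_zero hd]; exact hn1⟩
    exact ⟨x, hx.1, by rw [regGammaQ_eq_poissonTail hd hx.1, hxe]⟩
  have h1 : regGammaQInv d (1 / (n : ℝ)) ∈ Ici (0 : ℝ) := Function.invFunOn_mem hex
  have h2 : regGammaQ d (regGammaQInv d (1 / (n : ℝ))) = 1 / (n : ℝ) := Function.invFunOn_eq hex
  exact ⟨h1, by rw [← regGammaQ_eq_poissonTail hd h1, h2]⟩

/-! ### Hazard rates and expected maxima -/

/-- The Gamma distribution has an increasing hazard rate, so its log-tail lies below its
tangents. -/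
lemma poissonTail_le_exp {d : ℕ} (hd : 1 ≤ d) {q x : ℝ} (hq : 0 ≤ q) (hx : 0 ≤ x) :
    poissonTail d x ≤ poissonTail d q *
      Real.exp (-(gammaDensity d q / poissonTail d q * (x - q))) := by
  set h := gammaDensity d q / poissonTail d q with hh
  have hEq := poissonTail_pos hd hq
  -- The derivative of `F` at `y` has the sign of the hazard rate at `q` minus that at `y`, so
  -- monotonicity of the hazard rate makes `q` a maximum of `F`.
  let F : ℝ → ℝ := fun y => poissonTail d y * Real.exp (h * y)
  have hF : ∀ y, HasDerivAt F
      (-gammaDensity d y * Real.exp (h * y)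
        + poissonTail d y * (Real.exp (h * y) * (h * 1))) y := fun y =>
    (hasDerivAt_poissonTail hd y).mul ((hasDerivAt_id y).const_mul h).exp
  have hFe : ∀ y, -gammaDensity d y * Real.exp (h * y)
        + poissonTail d y * (Real.exp (h * y) * (h * 1)) =
      Real.exp (h * y) / poissonTail d q *
        (gammaDensity d q * poissonTail d y - gammaDensity d y * poissonTail d q) := by
    intro y
    rw [hh]
    field_simp
    ring
  have hcmp : ∀ y z : ℝ, 0 ≤ y → y ≤ z →
      gammaDensity d y * poissonTail d z ≤ gammaDensity d z * poissonTail d y := by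
    intro y z hy hyz
    have hz : 0 ≤ z := hy.trans hyz
    -- Termwise, `y^(d-1) z^k ≤ z^(d-1) y^k` for `y ≤ z`, because `k ≤ d - 1`.
    have key : y ^ (d - 1) * ∑ k ∈ Finset.range d, z ^ k / (k.factorial : ℝ) ≤
        z ^ (d - 1) * ∑ k ∈ Finset.range d, y ^ k / (k.factorial : ℝ) := by
      rw [Finset.mul_sum, Finset.mul_sum]
      refine Finset.sum_le_sum fun k hk => ?_
      have hk' : k < d := Finset.mem_range.1 hk
      have e : d - 1 = (d - 1 - k) + k := by omega
      have h1 : y ^ (d - 1 - k) ≤ z ^ (d - 1 - k) := pow_le_pow_left₀ hy hyz _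
      rw [e, pow_add, pow_add]
      have : 0 ≤ y ^ k * z ^ k / (k.factorial : ℝ) := by positivity
      calc y ^ (d - 1 - k) * y ^ k * (z ^ k / (k.factorial : ℝ))
          = y ^ (d - 1 - k) * (y ^ k * z ^ k / (k.factorial : ℝ)) := by ring
        _ ≤ z ^ (d - 1 - k) * (y ^ k * z ^ k / (k.factorial : ℝ)) := by gcongr
        _ = _ := by ring
    have e1 : gammaDensity d y * poissonTail d z =
        Real.exp (-y) * Real.exp (-z) / ((d - 1).factorial : ℝ) *
          (y ^ (d - 1) * ∑ k ∈ Finset.range d, z ^ k / (k.factorial : ℝ)) := by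
      unfold gammaDensity poissonTail; ring
    have e2 : gammaDensity d z * poissonTail d y =
        Real.exp (-y) * Real.exp (-z) / ((d - 1).factorial : ℝ) *
          (z ^ (d - 1) * ∑ k ∈ Finset.range d, y ^ k / (k.factorial : ℝ)) := by
      unfold gammaDensity poissonTail; ring
    rw [e1, e2]
    gcongr
  have hmax : F x ≤ F q := by
    rcases le_total x q with hxq | hqx
    · have hmono : MonotoneOn F (Icc 0 q) := by
        refine monotoneOn_of_hasDerivWithinAt_nonneg (convex_Icc 0 q)
          (fun y _ => (hF y).continuousAt.continuousWithinAt)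
          (fun y _ => (hF y).hasDerivWithinAt) ?_
        intro y hy
        rw [interior_Icc] at hy
        rw [hFe]
        have := hcmp y q hy.1.le hy.2.le
        exact mul_nonneg (by positivity) (by linarith)
      exact hmono ⟨hx, hxq⟩ ⟨hq, le_rfl⟩ hxq
    · have hanti : AntitoneOn F (Ici q) := by
        refine antitoneOn_of_hasDerivWithinAt_nonpos (convex_Ici q)
          (fun y _ => (hF y).continuousAt.continuousWithinAt)
          (fun y _ => (hF y).hasDerivWithinAt) ?_
        intro y hy
        rw [interior_Ici] at hy
        rw [hFe]
        have := hcmp q y hq (le_of_lt hy)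
        exact mul_nonpos_of_nonneg_of_nonpos (by positivity) (by linarith)
      exact hanti self_mem_Ici hqx hqx
  have e3 : Real.exp (-(h * (x - q))) = Real.exp (h * q) / Real.exp (h * x) := by
    rw [← Real.exp_sub]; congr 1; ring
  rw [e3, ← mul_div_assoc, le_div_iff₀ (Real.exp_pos _)]
  exact hmax

/-- This is the mean excess over `x₀` of the maximum of `n` exponential variables of rate `h`
started at `x₀`. With `w` their distribution function, `w' = h (1 - w)` and `1 - w^n = (1 - w) ∑
w^k`, so the integrand has an explicit primitive. -/
lemma lintegral_one_sub_one_sub_exp_pow {h : ℝ} (hh : 0 < h) (x₀ : ℝ) (n : ℕ) :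
    ∫⁻ t in Ioi x₀, ENNReal.ofReal (1 - (1 - Real.exp (-(h * (t - x₀)))) ^ n) =
      ENNReal.ofReal ((harmonic n : ℝ) / h) := by
  let w : ℝ → ℝ := fun t => 1 - Real.exp (-(h * (t - x₀)))
  have hw : ∀ t, HasDerivAt w (h * (1 - w t)) t := by
    intro t
    have h1 : HasDerivAt (fun t => -(h * (t - x₀))) (-(h * 1)) t :=
      (((hasDerivAt_id t).sub_const x₀).const_mul h).neg
    have h2 := h1.exp.const_sub 1
    exact h2.congr_deriv (by simp only [w]; ring)
  let G : ℝ → ℝ := fun t => ∑ k ∈ Finset.range n, w t ^ (k + 1) / (((k : ℝ) + 1) * h)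
  have hG : ∀ t, HasDerivAt G (1 - w t ^ n) t := by
    intro t
    have h1 : HasDerivAt G (∑ k ∈ Finset.range n,
        (((k + 1 : ℕ) : ℝ) * w t ^ k * (h * (1 - w t))) / (((k : ℝ) + 1) * h)) t := by
      refine HasDerivAt.fun_sum fun k _ => ?_
      simpa using ((hw t).pow (k + 1)).div_const (((k : ℝ) + 1) * h)
    refine h1.congr_deriv ?_
    symm
    rw [← mul_neg_geom_sum (w t) n, Finset.mul_sum]
    refine Finset.sum_congr rfl fun k _ => ?_
    have : ((k : ℝ) + 1) ≠ 0 := by positivity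
    push_cast
    field_simp
  have hw01 : ∀ t ∈ Ioi x₀, 0 ≤ w t ∧ w t ≤ 1 := by
    intro t ht
    have : 0 < t - x₀ := sub_pos.2 ht
    have h1 : Real.exp (-(h * (t - x₀))) ≤ 1 := by
      rw [Real.exp_le_one_iff]
      have := mul_pos hh this
      linarith
    have h2 := Real.exp_pos (-(h * (t - x₀)))
    constructor <;> simp only [w] <;> linarith
  have hpos : ∀ t ∈ Ioi x₀, 0 ≤ 1 - w t ^ n := fun t ht =>
    sub_nonneg.2 (pow_le_one₀ (hw01 t ht).1 (hw01 t ht).2)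
  have hwlim : Tendsto w atTop (𝓝 1) := by
    have h1 : Tendsto (fun t : ℝ => h * (t - x₀)) atTop atTop :=
      (tendsto_atTop_add_const_right _ (-x₀) tendsto_id).const_mul_atTop hh
    have h2 := (Real.tendsto_exp_neg_atTop_nhds_zero.comp h1).const_sub 1
    simpa [w, Function.comp_def] using h2
  have hGlim : Tendsto G atTop (𝓝 ((harmonic n : ℝ) / h)) := by
    have h1 : Tendsto G atTop
        (𝓝 (∑ k ∈ Finset.range n, (1 : ℝ) ^ (k + 1) / (((k : ℝ) + 1) * h))) :=
      tendsto_finsetSum _ fun k _ => (hwlim.pow (k + 1)).div_const _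
    convert h1 using 2
    rw [harmonic]
    push_cast
    rw [Finset.sum_div]
    refine Finset.sum_congr rfl fun k _ => ?_
    rw [one_pow, one_div, mul_inv]
    rfl
  have hint := integrableOn_Ioi_deriv_of_nonneg' (fun t _ => hG t) hpos hGlim
  have hval := integral_Ioi_of_hasDerivAt_of_nonneg' (fun t _ => hG t) hpos hGlim
  have hG0 : G x₀ = 0 := by
    simp [G, w]
  rw [hG0, sub_zero] at hval
  rw [← hval, ofReal_integral_eq_lintegral_ofReal hint]
  exact (ae_restrict_iff' measurableSet_Ioi).2 (ae_of_all _ hpos)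

/-- The tangent bound at `q` is the tail of an exponential of rate `n * gammaDensity d q` shifted to
`x₀`. The integrand is bounded by 1 below `x₀` and by its exponential counterpart above. -/
lemma lintegral_one_sub_one_sub_poissonTail_pow {d n : ℕ} (hd : 1 ≤ d) {q : ℝ} (hq : 0 ≤ q)
    (hn : 1 ≤ n) (hE : poissonTail d q = 1 / (n : ℝ)) (hf : 0 < gammaDensity d q) :
    ∫⁻ t in Ioi 0, ENNReal.ofReal (1 - (1 - poissonTail d t) ^ n) ≤
      ENNReal.ofReal (q + ((harmonic n : ℝ) - Real.log n) / (n * gammaDensity d q)) := by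
  have hn0 : (0 : ℝ) < n := by exact_mod_cast hn
  set h := (n : ℝ) * gammaDensity d q with hh
  have hh0 : 0 < h := mul_pos hn0 hf
  -- The factor `1/n = exp (-log n)` is absorbed into the shift; `q - log n / h` is where the
  -- tangent bound reaches 1.
  have htan : ∀ t, 0 ≤ t →
      poissonTail d t ≤ Real.exp (-(h * (t - (q - Real.log n / h)))) := by
    intro t ht
    have h1 := poissonTail_le_exp hd hq ht
    rw [hE] at h1
    refine h1.trans_eq ?_
    have : (1 : ℝ) / n = Real.exp (-Real.log n) := by
      rw [Real.exp_neg, Real.exp_log hn0, one_div]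
    rw [div_div_eq_mul_div, div_one, mul_comm (gammaDensity d q), ← hh, this, ← Real.exp_add]
    congr 1
    field_simp
    ring
  set x₀ := q - Real.log n / h with hx
  have hx0 : 0 ≤ x₀ := by
    have h1 := htan 0 le_rfl
    rw [poissonTail_zero hd, Real.one_le_exp_iff] at h1
    have h2 : 0 ≤ h * x₀ := by linarith
    exact nonneg_of_mul_nonneg_right h2 hh0
  rw [← Ioc_union_Ioi_eq_Ioi hx0]
  refine (lintegral_union_le _ _ _).trans ?_
  have hb1 : ∫⁻ t in Ioc 0 x₀, ENNReal.ofReal (1 - (1 - poissonTail d t) ^ n) ≤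
      ENNReal.ofReal x₀ := by
    calc ∫⁻ t in Ioc 0 x₀, ENNReal.ofReal (1 - (1 - poissonTail d t) ^ n)
        ≤ ∫⁻ t in Ioc 0 x₀, 1 := by
          refine setLIntegral_mono measurable_const fun t ht => ?_
          rw [← ENNReal.ofReal_one]
          refine ENNReal.ofReal_le_ofReal ?_
          have : 0 ≤ (1 - poissonTail d t) ^ n :=
            pow_nonneg (sub_nonneg.2 (poissonTail_le_one hd ht.1.le)) _
          linarith
      _ = ENNReal.ofReal x₀ := by simp
  have hb2 : ∫⁻ t in Ioi x₀, ENNReal.ofReal (1 - (1 - poissonTail d t) ^ n) ≤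
      ENNReal.ofReal ((harmonic n : ℝ) / h) := by
    rw [← lintegral_one_sub_one_sub_exp_pow hh0 x₀ n]
    refine setLIntegral_mono (by fun_prop) fun t ht => ENNReal.ofReal_le_ofReal ?_
    have ht0 : 0 ≤ t := hx0.trans (le_of_lt ht)
    have h1 := htan t ht0
    have h2 : Real.exp (-(h * (t - x₀))) ≤ 1 := by
      rw [Real.exp_le_one_iff]
      have := mul_pos hh0 (sub_pos.2 ht)
      linarith
    gcongr
  refine (add_le_add hb1 hb2).trans_eq ?_
  rw [← ENNReal.ofReal_add hx0 (by
    have : (0 : ℝ) ≤ (harmonic n : ℝ) := by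
      rw [harmonic]; push_cast; exact Finset.sum_nonneg fun i _ => by positivity
    positivity)]
  congr 1
  rw [hx]
  ring

/-- The mean of a nonnegative variable stochastically dominated by `c` times the maximum of `n`
independent Gamma variables. -/
lemma integrable_and_integral_le_of_dominated {Ω : Type*} [MeasurableSpace Ω] {μ : Measure Ω}
    [IsProbabilityMeasure μ] {Z : Ω → ℝ} (hZ : AEMeasurable Z μ) (hZ0 : ∀ ω, 0 ≤ Z ω)
    {c : ℝ} (hc : 0 < c) {d n : ℕ} (hd : 1 ≤ d) (hn : 1 ≤ n)
    (hdom : ∀ t, 0 ≤ t → ENNReal.ofReal ((1 - poissonTail d t) ^ n) ≤ μ {ω | Z ω ≤ c * t})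
    {q : ℝ} (hq : 0 ≤ q) (hE : poissonTail d q = 1 / (n : ℝ)) (hf : 0 < gammaDensity d q) :
    Integrable Z μ ∧
      ∫ ω, Z ω ∂μ ≤ c * (q + ((harmonic n : ℝ) - Real.log n) / (n * gammaDensity d q)) := by
  set B := q + ((harmonic n : ℝ) - Real.log n) / (n * gammaDensity d q) with hB
  have hY0 : ∀ ω, 0 ≤ Z ω / c := fun ω => div_nonneg (hZ0 ω) hc.le
  have hY : AEMeasurable (fun ω => Z ω / c) μ := hZ.div_const c
  have hlin : ∫⁻ ω, ENNReal.ofReal (Z ω / c) ∂μ ≤ ENNReal.ofReal B := by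
    rw [lintegral_eq_lintegral_meas_lt μ (ae_of_all _ hY0) hY]
    refine le_trans ?_ (lintegral_one_sub_one_sub_poissonTail_pow hd hq hn hE hf)
    refine setLIntegral_mono' measurableSet_Ioi fun t ht => ?_
    have ht0 : (0 : ℝ) ≤ t := le_of_lt ht
    have hset : {ω | t < Z ω / c} = {ω | Z ω ≤ c * t}ᶜ := by
      ext ω
      simp only [mem_ofPred_eq, mem_compl_iff, not_le]
      rw [lt_div_iff₀ hc, mul_comm]
    have hnm : NullMeasurableSet {ω | Z ω ≤ c * t} μ :=
      nullMeasurableSet_le hZ aemeasurable_const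
    rw [hset, prob_compl_eq_one_sub₀ hnm, ENNReal.ofReal_sub _
      (pow_nonneg (sub_nonneg.2 (poissonTail_le_one hd ht0)) _), ENNReal.ofReal_one]
    exact tsub_le_tsub_left (hdom t ht0) 1
  have hint : Integrable (fun ω => Z ω / c) μ := by
    refine ⟨hY.aestronglyMeasurable, ?_⟩
    rw [hasFiniteIntegral_iff_ofReal (ae_of_all _ hY0)]
    exact hlin.trans_lt ENNReal.ofReal_lt_top
  have hBn : 0 ≤ B := by
    have hlog : Real.log n ≤ (harmonic n : ℝ) := by
      have h1 := log_add_one_le_harmonic n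
      refine le_trans (Real.log_le_log (by exact_mod_cast hn) ?_) h1
      push_cast; linarith
    have : (0 : ℝ) < n := by exact_mod_cast hn
    have h2 : 0 ≤ (harmonic n : ℝ) - Real.log n := by linarith
    positivity
  have hle : ∫ ω, Z ω / c ∂μ ≤ B := by
    rw [integral_eq_lintegral_of_nonneg_ae (ae_of_all _ hY0) hY.aestronglyMeasurable]
    exact ENNReal.toReal_le_of_le_ofReal hBn hlin
  have hZe : Z = fun ω => c * (Z ω / c) := by
    ext ω; field_simp
  refine ⟨by rw [hZe]; exact hint.const_mul c, ?_⟩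
  rw [integral_div, div_le_iff₀ hc] at hle
  linarith

/-! ### Size of the scale and location constants -/

lemma regGammaQInv_pos {d n : ℕ} (hd : 1 ≤ d) (hn : 2 ≤ n) :
    0 < regGammaQInv d (1 / (n : ℝ)) := by
  obtain ⟨h0, h1⟩ := regGammaQInv_spec hd (n := n) (by omega)
  refine lt_of_le_of_ne h0 fun h => ?_
  rw [← h, poissonTail_zero hd, eq_div_iff (by positivity), one_mul] at h1
  have : n = 1 := by exact_mod_cast h1
  omega

lemma gammaDensity_regGammaQInv_pos {d n : ℕ} (hd : 1 ≤ d) (hdn : d ≤ n) :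
    0 < gammaDensity d (regGammaQInv d (1 / (n : ℝ))) := by
  rcases Nat.lt_or_ge n 2 with hn | hn
  -- The quantile may vanish only for `n = 1`; then `d = 1` and the power in the density is the
  -- zeroth one.
  · obtain rfl : d = 1 := by omega
    simp [gammaDensity, Real.exp_pos]
  · have := regGammaQInv_pos hd hn
    unfold gammaDensity
    positivity

/-- `a_{n,d} / 2` is the inverse hazard rate at the quantile. -/
lemma aConst_eq {d n : ℕ} (hd : 1 ≤ d) (hdn : d ≤ n) :
    aConst n d = 2 / (n * gammaDensity d (regGammaQInv d (1 / (n : ℝ)))) := by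
  have hn0 : (0 : ℝ) < n := by exact_mod_cast hd.trans hdn
  have hG : Real.Gamma d = ((d - 1).factorial : ℝ) := by
    rw [← Real.Gamma_nat_eq_factorial (d - 1), Nat.cast_sub hd, Nat.cast_one, sub_add_cancel]
  have hf := gammaDensity_regGammaQInv_pos hd hdn
  have hq := (regGammaQInv_spec hd (hd.trans hdn)).1
  unfold aConst
  set q := regGammaQInv d (1 / (n : ℝ)) with hqdef
  have hp : q ^ (1 - (d : ℝ)) = (q ^ (d - 1))⁻¹ := by
    rw [← Real.rpow_natCast, ← Real.rpow_neg hq, Nat.cast_sub hd, Nat.cast_one, neg_sub]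
  rw [hG, hp]
  unfold gammaDensity at hf ⊢
  have h1 : q ^ (d - 1) ≠ 0 := by
    intro h; rw [h] at hf; simp at hf
  have h2 : ((d - 1).factorial : ℝ) ≠ 0 := by positivity
  rw [Real.exp_neg]
  have h3 := (Real.exp_pos q).ne'
  field_simp

lemma two_le_aConst {d n : ℕ} (hd : 1 ≤ d) (hdn : d ≤ n) : 2 ≤ aConst n d := by
  have hn0 : (0 : ℝ) < n := by exact_mod_cast hd.trans hdn
  obtain ⟨hq, hE⟩ := regGammaQInv_spec hd (hd.trans hdn)
  have hf := gammaDensity_regGammaQInv_pos hd hdn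
  rw [aConst_eq hd hdn, le_div_iff₀ (by positivity)]
  have h1 := gammaDensity_le_poissonTail hd hq
  rw [hE, le_div_iff₀ hn0] at h1
  linarith

/-- A crude growth bound suffices: the quantile must be small compared with `n`, and the order `√n`
is enough for the Jensen gap. The tail is at most `2^d exp (-q/2)`, so `exp (q/2) ≤ 2^d n`, and the
term `q²/8` of the exponential series gives the claim. -/
lemma regGammaQInv_sq_le {d n : ℕ} (hd : 1 ≤ d) (hn : 1 ≤ n) :
    regGammaQInv d (1 / (n : ℝ)) ^ 2 ≤ 2 ^ (d + 3) * n := by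
  obtain ⟨hq, hE⟩ := regGammaQInv_spec hd hn
  set q := regGammaQInv d (1 / (n : ℝ))
  have hn0 : (0 : ℝ) < n := by exact_mod_cast hn
  have h1 : ∑ k ∈ Finset.range d, q ^ k / (k.factorial : ℝ) ≤ 2 ^ d * Real.exp (q / 2) := by
    refine le_trans ?_ (mul_le_mul_of_nonneg_left
      (Real.sum_le_exp_of_nonneg (by positivity) d) (by positivity))
    rw [Finset.mul_sum]
    refine Finset.sum_le_sum fun k hk => ?_
    have hk' : (2 : ℝ) ^ k ≤ 2 ^ d :=
      pow_le_pow_right₀ one_le_two (Finset.mem_range.1 hk).le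
    calc q ^ k / (k.factorial : ℝ) = 2 ^ k * ((q / 2) ^ k / (k.factorial : ℝ)) := by
          rw [div_pow]; field_simp
      _ ≤ _ := by gcongr
  have h2 : 1 / (n : ℝ) ≤ 2 ^ d * Real.exp (-(q / 2)) := by
    rw [← hE, poissonTail]
    calc Real.exp (-q) * ∑ k ∈ Finset.range d, q ^ k / (k.factorial : ℝ)
        ≤ Real.exp (-q) * (2 ^ d * Real.exp (q / 2)) := by gcongr
      _ = 2 ^ d * (Real.exp (-q) * Real.exp (q / 2)) := by ring
      _ = 2 ^ d * Real.exp (-(q / 2)) := by rw [← Real.exp_add]; congr 2; ring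
  have h3 : Real.exp (q / 2) ≤ 2 ^ d * n := by
    rw [Real.exp_neg, div_le_iff₀ hn0] at h2
    have := mul_le_mul_of_nonneg_right h2 (Real.exp_pos (q / 2)).le
    have e : 2 ^ d * (Real.exp (q / 2))⁻¹ * n * Real.exp (q / 2) = 2 ^ d * n := by
      field_simp
    linarith
  have h4 := Real.quadratic_le_exp_of_nonneg (x := q / 2) (by positivity)
  have : (2 : ℝ) ^ (d + 3) = 2 ^ d * 8 := by rw [pow_add]; norm_num
  rw [this]
  nlinarith

lemma harmonic_sub_log_le_one {n : ℕ} (hn : 1 ≤ n) :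
    (harmonic n : ℝ) - Real.log n ≤ 1 := by
  have h := Real.strictAnti_eulerMascheroniSeq'.antitone hn
  rwa [Real.eulerMascheroniSeq'_one, Real.eulerMascheroniSeq',
    if_neg (by omega)] at h

lemma harmonic_sub_log_le {n : ℕ} (hn : 1 ≤ n) :
    (harmonic n : ℝ) - Real.log n ≤ Real.eulerMascheroniConstant + 1 / n := by
  have hn0 : (0 : ℝ) < n := by exact_mod_cast hn
  have h := (Real.eulerMascheroniSeq_lt_eulerMascheroniConstant n).le
  rw [Real.eulerMascheroniSeq] at h
  have h1 : Real.log (n + 1) - Real.log n ≤ 1 / n := by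
    rw [← Real.log_div (by positivity) hn0.ne']
    refine (Real.log_le_sub_one_of_pos (by positivity)).trans_eq ?_
    field_simp
    ring
  linarith

lemma exp_neg_one_le_one_sub_inv_pow {m : ℕ} (hm : 1 ≤ m) :
    Real.exp (-1) ≤ (1 - 1 / ((m : ℝ) + 1)) ^ m := by
  have hm0 : (0 : ℝ) < m := by exact_mod_cast hm
  have h1 : Real.exp (-(1 / (m : ℝ))) ≤ 1 - 1 / ((m : ℝ) + 1) := by
    have h2 := Real.add_one_le_exp (1 / (m : ℝ))
    have h3 : 1 - 1 / ((m : ℝ) + 1) = (1 / (m : ℝ) + 1)⁻¹ := by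
      field_simp; ring
    rw [h3, Real.exp_neg]
    exact inv_anti₀ (by positivity) h2
  have h2 := pow_le_pow_left₀ (Real.exp_pos _).le h1 m
  rw [← Real.exp_nat_mul] at h2
  refine le_trans (le_of_eq ?_) h2
  congr 1
  field_simp

/-- This is the probability that all `n` variables lie below their common `1 - 1/n` quantile. -/
lemma one_quarter_le_one_sub_inv_pow {n : ℕ} (hn : 4 ≤ n) :
    1 / 4 ≤ (1 - 1 / (n : ℝ)) ^ n := by
  obtain ⟨m, rfl⟩ : ∃ m, n = m + 1 := ⟨n - 1, by omega⟩
  have h1 := exp_neg_one_le_one_sub_inv_pow (m := m) (by omega)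
  have h2 : (3 : ℝ) / 4 ≤ 1 - 1 / ((m : ℝ) + 1) := by
    have : 1 / ((m : ℝ) + 1) ≤ 1 / 4 :=
      one_div_le_one_div_of_le (by norm_num) (by exact_mod_cast hn)
    linarith
  have h3 : (1 : ℝ) / 3 ≤ Real.exp (-1) := by
    rw [Real.exp_neg, one_div]
    exact inv_anti₀ (Real.exp_pos 1) Real.exp_one_lt_three.le
  push_cast
  rw [pow_succ]
  calc (1 : ℝ) / 4 = 1 / 3 * (3 / 4) := by norm_num
    _ ≤ _ := mul_le_mul (h3.trans h1) h2 (by norm_num) (by linarith [Real.exp_pos (-1)])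

/-! ### Jensen's inequality with and without a gap -/

/-- Jensen's inequality for `z ↦ log (1 + P z)`. -/
lemma integral_log_one_add_le {Ω : Type*} [MeasurableSpace Ω] {μ : Measure Ω}
    [IsProbabilityMeasure μ] {Z : Ω → ℝ} (hZ : Integrable Z μ) (hZ0 : ∀ ω, 0 ≤ Z ω)
    {P m : ℝ} (hP : 0 < P) (hm : 0 ≤ m) (hZm : ∫ ω, Z ω ∂μ ≤ m)
    (hlog : Integrable (fun ω => Real.log (1 + P * Z ω)) μ) :
    ∫ ω, Real.log (1 + P * Z ω) ∂μ ≤ Real.log (1 + P * m) := by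
  have hc : 0 < 1 + P * m := by positivity
  have hpt : ∀ ω, Real.log (1 + P * Z ω) ≤
      Real.log (1 + P * m) + P / (1 + P * m) * (Z ω - m) := by
    intro ω
    have hy : 0 < 1 + P * Z ω := by have := hZ0 ω; positivity
    have h1 := Real.log_le_sub_one_of_pos (div_pos hy hc)
    rw [Real.log_div hy.ne' hc.ne'] at h1
    have h2 : (1 + P * Z ω) / (1 + P * m) - 1 = P / (1 + P * m) * (Z ω - m) := by
      field_simp; ring
    linarith
  have hmi : Integrable (fun _ : Ω => m) μ := integrable_const m
  have hi0 : Integrable (fun ω => P / (1 + P * m) * (Z ω - m)) μ := (hZ.sub hmi).const_mul _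
  have hrhs : Integrable (fun ω => Real.log (1 + P * m) + P / (1 + P * m) * (Z ω - m)) μ :=
    (integrable_const _).add hi0
  refine (integral_mono hlog hrhs hpt).trans ?_
  rw [integral_add (integrable_const _) hi0, integral_const_mul,
    integral_sub hZ hmi]
  simp only [integral_const, probReal_univ, smul_eq_mul, one_mul]
  have : P / (1 + P * m) * (∫ ω, Z ω ∂μ - m) ≤ 0 :=
    mul_nonpos_of_nonneg_of_nonpos (by positivity) (by linarith)
  linarith

/-- With `z = s²`, `log z = 2 log s ≤ 2 (s - 1) = z - 1 - (1 - s)²`, and `(1 - s)² ≥ (1 - s²)² / 4`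
since `1 + s ≤ 2`. -/
lemma log_le_sub_one_sub_sq {z : ℝ} (hz : 0 < z) (hz1 : z ≤ 1) :
    Real.log z ≤ z - 1 - (1 - z) ^ 2 / 4 := by
  obtain ⟨s, hs, rfl⟩ : ∃ s : ℝ, 0 < s ∧ z = s ^ 2 :=
    ⟨√z, Real.sqrt_pos.2 hz, (Real.sq_sqrt hz.le).symm⟩
  have hs1 : s ≤ 1 := by nlinarith
  have h1 := Real.log_le_sub_one_of_pos hs
  rw [Real.log_pow]
  push_cast
  have h2 : (1 - s ^ 2) ^ 2 / 4 ≤ (1 - s) ^ 2 := by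
    have e : (1 - s ^ 2) ^ 2 = (1 - s) ^ 2 * (1 + s) ^ 2 := by ring
    have : (1 + s) ^ 2 ≤ 4 := by nlinarith
    rw [e]
    nlinarith [mul_le_mul_of_nonneg_left this (sq_nonneg (1 - s))]
  nlinarith

/-- Jensen's inequality for `z ↦ log (1 + P z)` with a gap: the mean may exceed `m` by `δ` if
`Z` stays below `m - e` with probability at least `1/4`. -/
lemma integral_log_one_add_le_of_gap {Ω : Type*} [MeasurableSpace Ω] {μ : Measure Ω}
    [IsProbabilityMeasure μ] {Z : Ω → ℝ} (hZ : Integrable Z μ) (hZ0 : ∀ ω, 0 ≤ Z ω)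
    {P m e δ : ℝ} (hP : 0 < P) (hm : 0 ≤ m) (he : 0 ≤ e) (hZm : ∫ ω, Z ω ∂μ ≤ m + δ)
    (hgap : 16 * δ * (1 + P * m) ≤ P * e ^ 2)
    (hprob : ENNReal.ofReal (1 / 4) ≤ μ {ω | Z ω ≤ m - e})
    (hlog : Integrable (fun ω => Real.log (1 + P * Z ω)) μ) :
    ∫ ω, Real.log (1 + P * Z ω) ∂μ ≤ Real.log (1 + P * m) := by
  set c := 1 + P * m with hcdef
  have hc : 0 < c := by positivity
  set S := {ω | Z ω ≤ m - e} with hS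
  have hSm : NullMeasurableSet S μ := nullMeasurableSet_le hZ.aemeasurable aemeasurable_const
  -- On `S` the logarithm lies at least `κ` below its tangent at `m`. As `S` has probability at
  -- least 1/4, the expected saving is at least `κ / 4`, and `hgap` says exactly that this covers
  -- the loss `P δ / c`.
  set κ := (P * e / c) ^ 2 / 4 with hκ
  have hpt : ∀ ω, Real.log (1 + P * Z ω) ≤
      Real.log c + P / c * (Z ω - m) - S.indicator (fun _ => κ) ω := by
    intro ω
    have hy : 0 < 1 + P * Z ω := by have := hZ0 ω; positivity
    have h2 : (1 + P * Z ω) / c - 1 = P / c * (Z ω - m) := by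
      rw [hcdef]; field_simp; ring
    by_cases hω : ω ∈ S
    · have hω' : Z ω ≤ m - e := hω
      rw [indicator_of_mem hω]
      have h3 : (1 + P * Z ω) / c ≤ 1 - P * e / c := by
        have : P / c * (Z ω - m) ≤ P / c * (-e) :=
          mul_le_mul_of_nonneg_left (by linarith) (by positivity)
        have e2 : P / c * (-e) = - (P * e / c) := by ring
        linarith
      have h4 : 0 ≤ P * e / c := by positivity
      have h1 := log_le_sub_one_sub_sq (div_pos hy hc) (by linarith)
      rw [Real.log_div hy.ne' hc.ne'] at h1
      have h5 : (P * e / c) ^ 2 ≤ (1 - (1 + P * Z ω) / c) ^ 2 :=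
        pow_le_pow_left₀ h4 (by linarith) 2
      linarith
    · rw [indicator_of_notMem hω]
      have h1 := Real.log_le_sub_one_of_pos (div_pos hy hc)
      rw [Real.log_div hy.ne' hc.ne'] at h1
      linarith
  have hmi : Integrable (fun _ : Ω => m) μ := integrable_const m
  have hi0 : Integrable (fun ω => P / c * (Z ω - m)) μ := (hZ.sub hmi).const_mul _
  have hi1 : Integrable (fun ω => Real.log c + P / c * (Z ω - m)) μ :=
    (integrable_const _).add hi0
  have hi2 : Integrable (S.indicator fun _ => κ) μ := (integrable_const κ).indicator₀ hSm
  refine (integral_mono hlog (hi1.sub hi2) hpt).trans ?_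
  have hsub : ∫ ω, ((fun ω => Real.log c + P / c * (Z ω - m)) - S.indicator fun _ => κ) ω ∂μ =
      ∫ ω, (Real.log c + P / c * (Z ω - m)) ∂μ - ∫ ω, S.indicator (fun _ => κ) ω ∂μ :=
    integral_sub hi1 hi2
  rw [hsub, integral_add (integrable_const _) hi0,
    integral_const_mul, integral_sub hZ hmi, integral_indicator₀ hSm]
  simp only [integral_const, probReal_univ, smul_eq_mul, one_mul, MeasurableSet.univ,
    measureReal_restrict_apply, univ_inter]
  have hreal : 1 / 4 ≤ μ.real S := by
    rw [measureReal_def]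
    exact (ENNReal.ofReal_le_iff_le_toReal (measure_ne_top μ S)).1 hprob
  have h1 : P / c * (∫ ω, Z ω ∂μ - m) ≤ P / c * δ :=
    mul_le_mul_of_nonneg_left (by linarith) (by positivity)
  have h2 : 1 / 4 * κ ≤ μ.real S * κ := mul_le_mul_of_nonneg_right hreal (by positivity)
  have h3 : P / c * δ ≤ 1 / 4 * κ := by
    rw [hκ]
    have e1 : P / c * δ = P / (16 * c ^ 2) * (16 * δ * c) := by field_simp
    have e2 : 1 / 4 * ((P * e / c) ^ 2 / 4) = P / (16 * c ^ 2) * (P * e ^ 2) := by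
      field_simp; ring
    rw [e1, e2]
    exact mul_le_mul_of_nonneg_left hgap (by positivity)
  linarith

lemma integrable_log_one_add {Ω : Type*} [MeasurableSpace Ω] {μ : Measure Ω}
    {Z : Ω → ℝ} (hZ : Integrable Z μ) (hZ0 : ∀ ω, 0 ≤ Z ω) {P : ℝ} (hP : 0 < P) :
    Integrable (fun ω => Real.log (1 + P * Z ω)) μ := by
  refine (hZ.const_mul P).mono'
    (Real.measurable_log.comp_aemeasurable
      ((hZ.aemeasurable.const_mul P).const_add 1)).aestronglyMeasurable (ae_of_all _ fun ω => ?_)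
  have h0 : 0 ≤ P * Z ω := mul_nonneg hP.le (hZ0 ω)
  rw [Real.norm_eq_abs, abs_of_nonneg (Real.log_nonneg (by linarith))]
  have := Real.log_le_sub_one_of_pos (show 0 < 1 + P * Z ω by linarith)
  linarith

/-! ### Rates of dominated streams -/

/-- The rate of a stream whose gain is dominated by the maximum of `n` Gamma variables. -/
lemma rate_le_of_dominated_half {Ω : Type*} [MeasurableSpace Ω] {μ : Measure Ω}
    [IsProbabilityMeasure μ] {Z : Ω → ℝ} (hZ : AEMeasurable Z μ) (hZ0 : ∀ ω, 0 ≤ Z ω)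
    {d n : ℕ} (hd : 1 ≤ d) (hdn : d ≤ n)
    (hdom : ∀ t, 0 ≤ t → ENNReal.ofReal ((1 - poissonTail d t) ^ n) ≤ μ {ω | Z ω ≤ 1 * t})
    {P : ℝ} (hP : 0 < P) :
    Integrable (fun ω => Real.log (1 + P * Z ω)) μ ∧
      ∫ ω, Real.log (1 + P * Z ω) ∂μ ≤
        Real.log (1 + P * (bConst n d + Real.eulerMascheroniConstant * aConst n d)) := by
  have hn : 1 ≤ n := hd.trans hdn
  have hn0 : (0 : ℝ) < n := by exact_mod_cast hn
  obtain ⟨hq, hE⟩ := regGammaQInv_spec hd hn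
  have hf := gammaDensity_regGammaQInv_pos hd hdn
  obtain ⟨hi, hle⟩ :=
    integrable_and_integral_le_of_dominated hZ hZ0 one_pos hd hn hdom hq hE hf
  have hlog := integrable_log_one_add hi hZ0 hP
  have ha := two_le_aConst hd hdn
  have hae := aConst_eq hd hdn
  have hγ := Real.one_half_lt_eulerMascheroniConstant
  unfold bConst
  set q := regGammaQInv d (1 / (n : ℝ))
  set γ := Real.eulerMascheroniConstant
  refine ⟨hlog, integral_log_one_add_le hi hZ0 hP (by positivity) ?_ hlog⟩
  have h1 : ((harmonic n : ℝ) - Real.log n) / (n * gammaDensity d q) =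
      ((harmonic n : ℝ) - Real.log n) * (aConst n d / 2) := by
    rw [hae]; field_simp
  rw [h1] at hle
  have h2 : ((harmonic n : ℝ) - Real.log n) * (aConst n d / 2) ≤ 1 * (aConst n d / 2) :=
    mul_le_mul_of_nonneg_right (harmonic_sub_log_le_one hn) (by linarith)
  have h3 : 1 / 2 * aConst n d ≤ γ * aConst n d :=
    mul_le_mul_of_nonneg_right hγ.le (by linarith)
  linarith

/-- Here the bound on the mean is too large by `a/n`, so plain Jensen is not enough. The two lower
bounds on `n` make `q` and `1/P` small compared with `n`, which lets the gap pay for `a/n`. -/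
lemma rate_le_of_dominated_one {Ω : Type*} [MeasurableSpace Ω] {μ : Measure Ω}
    [IsProbabilityMeasure μ] {Z : Ω → ℝ} (hZ : AEMeasurable Z μ) (hZ0 : ∀ ω, 0 ≤ Z ω)
    {d n : ℕ} (hd : 1 ≤ d) (hdn : d ≤ n)
    (hdom : ∀ t, 0 ≤ t → ENNReal.ofReal ((1 - poissonTail d t) ^ n) ≤ μ {ω | Z ω ≤ 2 * t})
    {P : ℝ} (hP : 0 < P) (hnd : 2 ^ (d + 19) ≤ n) (hnP : 128 / P ≤ n) :
    Integrable (fun ω => Real.log (1 + P * Z ω)) μ ∧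
      ∫ ω, Real.log (1 + P * Z ω) ∂μ ≤
        Real.log (1 + P * (bConst n d + Real.eulerMascheroniConstant * aConst n d)) := by
  have hn : 1 ≤ n := hd.trans hdn
  have hn0 : (0 : ℝ) < n := by exact_mod_cast hn
  obtain ⟨hq, hE⟩ := regGammaQInv_spec hd hn
  have hf := gammaDensity_regGammaQInv_pos hd hdn
  obtain ⟨hi, hle⟩ :=
    integrable_and_integral_le_of_dominated hZ hZ0 two_pos hd hn hdom hq hE hf
  have hlog := integrable_log_one_add hi hZ0 hP
  have ha := two_le_aConst hd hdn
  have hae := aConst_eq hd hdn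
  have hγ := Real.one_half_lt_eulerMascheroniConstant
  have hγ1 := Real.eulerMascheroniConstant_lt_two_thirds
  have hqsq := regGammaQInv_sq_le hd hn
  unfold bConst
  set q := regGammaQInv d (1 / (n : ℝ))
  set γ := Real.eulerMascheroniConstant
  set a := aConst n d
  have hnd' : (2 : ℝ) ^ (d + 19) ≤ n := by exact_mod_cast hnd
  have hn128 : (128 : ℝ) ≤ n := by
    refine le_trans ?_ hnd'
    calc (128 : ℝ) = 2 ^ 7 := by norm_num
      _ ≤ 2 ^ (d + 19) := pow_le_pow_right₀ one_le_two (by omega)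
  -- The choice of `e` makes `m - e = 2q`, the scaled quantile, and `δ` comes from `H_n - log n ≤ γ
  -- + 1/n`.
  refine ⟨hlog, integral_log_one_add_le_of_gap (e := γ * a) (δ := a / n) hi hZ0 hP
    (by positivity) (by positivity) ?_ ?_ ?_ hlog⟩
  · have h1 : ((harmonic n : ℝ) - Real.log n) / (n * gammaDensity d q) =
        ((harmonic n : ℝ) - Real.log n) * (a / 2) := by
      rw [hae]; field_simp
    rw [h1] at hle
    have h2 : ((harmonic n : ℝ) - Real.log n) * (a / 2) ≤ (γ + 1 / n) * (a / 2) :=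
      mul_le_mul_of_nonneg_right (harmonic_sub_log_le hn) (by linarith)
    have h3 : (γ + 1 / n) * (a / 2) * 2 = γ * a + a / n := by field_simp
    linarith
  · have hq1 : 256 * q ≤ n := by
      have : (256 * q) ^ 2 ≤ (n : ℝ) ^ 2 := by
        calc (256 * q) ^ 2 = (2 : ℝ) ^ 16 * q ^ 2 := by ring
          _ ≤ (2 : ℝ) ^ 16 * ((2 : ℝ) ^ (d + 3) * n) := by gcongr
          _ = (2 : ℝ) ^ (d + 19) * n := by rw [pow_add, pow_add]; ring
          _ ≤ (n : ℝ) * n := by gcongr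
          _ = (n : ℝ) ^ 2 := by ring
      exact (pow_le_pow_iff_left₀ (by positivity) hn0.le two_ne_zero).1 this
    have hP1 : 128 ≤ n * P := by rwa [div_le_iff₀ hP] at hnP
    -- The three terms on the left take at most 1/4, 1/4 and 1/2 of the right side, using `128 ≤
    -- nP`, `256 q ≤ n` and `128 ≤ n`, together with `2 ≤ a` for the first two.
    have hkey : 64 * (1 + P * (2 * q + γ * a)) ≤ n * P * a := by
      have h1 : P * (256 * q) ≤ P * n := by gcongr
      have h2 : P * γ * a ≤ P * a := by
        have : γ * a ≤ 1 * a := mul_le_mul_of_nonneg_right (by linarith) (by linarith)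
        nlinarith
      have h3 : 128 * (P * a) ≤ n * (P * a) := by gcongr
      have h4 : n * P * 2 ≤ n * P * a := by gcongr
      nlinarith
    have hγ4 : 1 / 4 * a ^ 2 ≤ γ ^ 2 * a ^ 2 := by
      have : 1 / 4 ≤ γ ^ 2 := by nlinarith
      gcongr
    calc 16 * (a / n) * (1 + P * (2 * q + γ * a))
        = a / (4 * n) * (64 * (1 + P * (2 * q + γ * a))) := by field_simp; ring
      _ ≤ a / (4 * n) * (n * P * a) := by gcongr
      _ = P * (1 / 4 * a ^ 2) := by field_simp
      _ ≤ P * (γ ^ 2 * a ^ 2) := by gcongr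
      _ = P * (γ * a) ^ 2 := by ring
  · have h1 := hdom q hq
    rw [show 2 * q + γ * a - γ * a = 2 * q by ring]
    refine le_trans (ENNReal.ofReal_le_ofReal ?_) h1
    rw [hE]
    exact one_quarter_le_one_sub_inv_pow (by exact_mod_cast (by linarith : (4 : ℝ) ≤ n))

/-! ### Isotropic Gaussian measures -/

section Isotropic

variable {V : Type*} [NormedAddCommGroup V] [InnerProductSpace ℝ V] [FiniteDimensional ℝ V]
  [MeasurableSpace V] [BorelSpace V]

/-- The centred isotropic Gaussian measure with variance `v` per real dimension, characterized by
its characteristic function. -/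
def IsotropicGaussian (v : ℝ) (ν : Measure V) : Prop :=
  ∀ t : V, charFun ν t = Complex.exp (-(v * ‖t‖ ^ 2 / 2))

/-- The unnormalized isotropic Gaussian density. -/
noncomputable def gaussWeight (v s : ℝ) : ℝ := Real.exp (-(1 / (2 * v)) * s ^ 2)

lemma integral_gaussWeight_cexp {v : ℝ} (hv : 0 < v) (t : V) :
    ∫ x : V, (gaussWeight v ‖x‖ : ℂ) * Complex.exp (inner ℝ x t * Complex.I) =
      (∫ x : V, (gaussWeight v ‖x‖ : ℂ)) * Complex.exp (-(v * ‖t‖ ^ 2 / 2)) := by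
  have hb : 0 < ((1 / (2 * v) : ℝ) : ℂ).re := by
    rw [Complex.ofReal_re]; positivity
  have h1 := GaussianFourier.integral_cexp_neg_mul_sq_norm_add hb Complex.I t
  have h2 := GaussianFourier.integral_cexp_neg_mul_sq_norm (V := V) hb
  have e1 : ∀ x : V, (gaussWeight v ‖x‖ : ℂ) * Complex.exp (inner ℝ x t * Complex.I) =
      Complex.exp (-((1 / (2 * v) : ℝ) : ℂ) * (‖x‖ : ℂ) ^ 2 + Complex.I * inner ℝ t x) := by
    intro x
    rw [gaussWeight, Complex.ofReal_exp, ← Complex.exp_add, real_inner_comm]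
    congr 1
    push_cast
    ring
  have e2 : ∀ x : V, (gaussWeight v ‖x‖ : ℂ) =
      Complex.exp (-((1 / (2 * v) : ℝ) : ℂ) * (‖x‖ : ℂ) ^ 2) := by
    intro x
    rw [gaussWeight, Complex.ofReal_exp]
    push_cast
    rfl
  simp_rw [e1, e2]
  rw [h1, h2]
  congr 2
  have : (v : ℂ) ≠ 0 := by exact_mod_cast hv.ne'
  rw [Complex.I_sq]
  push_cast
  field_simp
  ring

lemma integrable_gaussWeight {v : ℝ} (hv : 0 < v) : Integrable (fun x : V => gaussWeight v ‖x‖) := by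
  have hb : 0 < (1 / (2 * v)) := by positivity
  have := GaussianFourier.integrable_cexp_neg_mul_sq_norm_add (V := V)
    (b := ((1 / (2 * v) : ℝ) : ℂ)) (by rw [Complex.ofReal_re]; exact hb) 0 0
  refine (this.norm).congr (ae_of_all _ fun x => ?_)
  simp only [gaussWeight, Complex.norm_exp]
  congr 1
  simp [← Complex.ofReal_pow, ← Complex.ofReal_mul, ← Complex.ofReal_neg]

lemma integral_gaussWeight_pos {v : ℝ} (hv : 0 < v) : 0 < ∫ x : V, gaussWeight v ‖x‖ := by
  rw [integral_pos_iff_support_of_nonneg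
    (fun x => show 0 ≤ gaussWeight v ‖x‖ from (Real.exp_pos _).le) (integrable_gaussWeight hv)]
  have : Function.support (fun x : V => gaussWeight v ‖x‖) = univ := by
    ext x; simp [gaussWeight, Real.exp_ne_zero]
  rw [this]
  exact Measure.measure_univ_pos.2 (NeZero.ne _)

/-- Both measures have the same characteristic function, which determines a finite measure. The
density makes polar coordinates and null sets accessible. -/
lemma IsotropicGaussian.eq_withDensity {v : ℝ} (hv : 0 < v) {ν : Measure V}
    [IsProbabilityMeasure ν] (hν : IsotropicGaussian v ν) :
    ν = (volume : Measure V).withDensity fun x =>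
      ENNReal.ofReal ((∫ y : V, gaussWeight v ‖y‖)⁻¹ * gaussWeight v ‖x‖) := by
  set c := ∫ y : V, gaussWeight v ‖y‖ with hc
  have hc0 : 0 < c := integral_gaussWeight_pos hv
  have hnn : ∀ x : V, 0 ≤ c⁻¹ * gaussWeight v ‖x‖ := fun x =>
    mul_nonneg (inv_nonneg.2 hc0.le) (Real.exp_pos _).le
  have hmeas : Measurable fun x : V => ENNReal.ofReal (c⁻¹ * gaussWeight v ‖x‖) := by
    unfold gaussWeight; fun_prop
  have hfin : IsFiniteMeasure ((volume : Measure V).withDensity fun x =>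
      ENNReal.ofReal (c⁻¹ * gaussWeight v ‖x‖)) := by
    refine isFiniteMeasure_withDensity_ofReal ?_
    exact ((integrable_gaussWeight hv).const_mul _).hasFiniteIntegral
  refine Measure.ext_of_charFun (funext fun t => ?_)
  rw [hν t, charFun_apply, integral_withDensity_eq_integral_toReal_smul hmeas
    (ae_of_all _ fun _ => ENNReal.ofReal_lt_top)]
  have e : ∀ x : V, (ENNReal.ofReal (c⁻¹ * gaussWeight v ‖x‖)).toReal •
      Complex.exp (inner ℝ x t * Complex.I) =
      (c : ℂ)⁻¹ * ((gaussWeight v ‖x‖ : ℂ) * Complex.exp (inner ℝ x t * Complex.I)) := by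
    intro x
    rw [ENNReal.toReal_ofReal (hnn x), Complex.real_smul]
    push_cast
    ring
  simp_rw [e]
  rw [integral_const_mul, integral_gaussWeight_cexp hv, integral_complex_ofReal, ← hc,
    inv_mul_cancel_left₀]
  exact_mod_cast hc0.ne'

/-- In polar coordinates the substitution `y² / (2v)` turns the radial density in real dimension
`2d` into the Gamma density of shape `d`. -/
lemma IsotropicGaussian.measureReal_norm_sq_gt {v : ℝ} (hv : 0 < v) {ν : Measure V}
    [IsProbabilityMeasure ν] (hν : IsotropicGaussian v ν) {d : ℕ} (hd : 1 ≤ d)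
    (hdim : Module.finrank ℝ V = 2 * d) {s : ℝ} (hs : 0 ≤ s) :
    ν.real {x | s < ‖x‖ ^ 2} = poissonTail d (s / (2 * v)) := by
  have : Nontrivial V := Module.nontrivial_of_finrank_pos (R := ℝ) (by omega)
  set c := ∫ y : V, gaussWeight v ‖y‖ with hc
  have hc0 : 0 < c := integral_gaussWeight_pos hv
  have hmeas : Measurable fun x : V => ENNReal.ofReal (c⁻¹ * gaussWeight v ‖x‖) := by
    unfold gaussWeight; fun_prop
  have hnn : ∀ x : V, 0 ≤ c⁻¹ * gaussWeight v ‖x‖ := fun x =>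
    mul_nonneg (inv_nonneg.2 hc0.le) (Real.exp_pos _).le
  have hpolar : ∀ f : ℝ → ℝ, ∫ x, f ‖x‖ ∂ν = (((2 * d : ℕ) : ℝ) * (volume : Measure V).real
      (Metric.ball 0 1) * c⁻¹) * ∫ y in Ioi (0 : ℝ), y ^ (2 * d - 1) * (gaussWeight v y * f y) := by
    intro f
    rw [hν.eq_withDensity hv, integral_withDensity_eq_integral_toReal_smul hmeas
      (ae_of_all _ fun _ => ENNReal.ofReal_lt_top)]
    have := integral_fun_norm_addHaar (volume : Measure V)
      (fun y => c⁻¹ * (gaussWeight v y * f y))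
    rw [hdim] at this
    have e : ∀ x : V, (ENNReal.ofReal (c⁻¹ * gaussWeight v ‖x‖)).toReal • f ‖x‖ =
        c⁻¹ * (gaussWeight v ‖x‖ * f ‖x‖) := by
      intro x
      rw [ENNReal.toReal_ofReal (hnn x), smul_eq_mul, mul_assoc]
    simp_rw [e, this]
    simp only [smul_eq_mul, nsmul_eq_mul]
    have e2 : ∀ y : ℝ, y ^ (2 * d - 1) * (c⁻¹ * (gaussWeight v y * f y)) =
        c⁻¹ * (y ^ (2 * d - 1) * (gaussWeight v y * f y)) := fun y => by ring
    simp_rw [e2]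
    rw [integral_const_mul]
    ring
  have hder : ∀ y : ℝ, HasDerivAt (fun y => poissonTail d (y ^ 2 / (2 * v)))
      (-gammaDensity d (y ^ 2 / (2 * v)) * (((2 : ℕ) : ℝ) * y ^ (2 - 1) / (2 * v))) y := fun y =>
    (hasDerivAt_poissonTail hd _).comp y ((hasDerivAt_pow 2 y).div_const (2 * v))
  have hlim : Tendsto (fun y : ℝ => poissonTail d (y ^ 2 / (2 * v))) atTop (𝓝 0) :=
    (tendsto_poissonTail d).comp
      ((tendsto_pow_atTop two_ne_zero).atTop_div_const (by positivity))
  set κ : ℝ := v * (2 * v) ^ (d - 1) * ((d - 1).factorial : ℝ) with hκ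
  have htail : ∀ a : ℝ, 0 ≤ a → ∫ y in Ioi a, y ^ (2 * d - 1) * gaussWeight v y =
      κ * poissonTail d (a ^ 2 / (2 * v)) := by
    intro a ha
    have h1 := integral_Ioi_of_hasDerivAt_of_nonpos' (a := a) (fun y _ => hder y)
      (fun y hy => by
        have hy0 : 0 < y := lt_of_le_of_lt ha hy
        have := gammaDensity_nonneg d (x := y ^ 2 / (2 * v)) (by positivity)
        rw [neg_mul]
        exact neg_nonpos.2 (by positivity)) hlim
    have e : ∀ y : ℝ, y ^ (2 * d - 1) * gaussWeight v y =
        (-κ) * (-gammaDensity d (y ^ 2 / (2 * v)) *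
          (((2 : ℕ) : ℝ) * y ^ (2 - 1) / (2 * v))) := by
      intro y
      have e1 : -(y ^ 2 / (2 * v)) = -(1 / (2 * v)) * y ^ 2 := by ring
      rw [gammaDensity, gaussWeight, hκ, e1, div_pow]
      obtain ⟨m, rfl⟩ : ∃ m, d = m + 1 := ⟨d - 1, by omega⟩
      have e2 : 2 * (m + 1) - 1 = 2 * m + 1 := by omega
      rw [e2, Nat.add_sub_cancel, ← pow_mul]
      have : (m.factorial : ℝ) ≠ 0 := by positivity
      push_cast
      field_simp
      ring
    simp_rw [e]
    rw [integral_const_mul, h1]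
    ring
  -- Taking the constant function 1 shows that ball volume, normalization and `κ` multiply to 1, so
  -- none of them has to be computed.
  have htot := hpolar fun _ => 1
  simp only [integral_const, probReal_univ, smul_eq_mul, mul_one] at htot
  rw [htail 0 le_rfl] at htot
  have hind := hpolar ((Ioi (√s)).indicator fun _ => 1)
  have e3 : ∀ x : V, (Ioi (√s)).indicator (fun _ => (1 : ℝ)) ‖x‖ =
      {x : V | s < ‖x‖ ^ 2}.indicator (fun _ => 1) x := by
    intro x
    have : ‖x‖ ∈ Ioi (√s) ↔ x ∈ {x : V | s < ‖x‖ ^ 2} := by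
      rw [mem_Ioi, mem_ofPred_eq, ← not_le, ← not_le, Real.le_sqrt (norm_nonneg x) hs]
    by_cases h : x ∈ {x : V | s < ‖x‖ ^ 2}
    · rw [indicator_of_mem h, indicator_of_mem (this.2 h)]
    · rw [indicator_of_notMem h, indicator_of_notMem (fun h' => h (this.1 h'))]
  have hmS : MeasurableSet {x : V | s < ‖x‖ ^ 2} :=
    measurableSet_lt measurable_const (by fun_prop)
  have e4 : ∀ y : ℝ, y ^ (2 * d - 1) * (gaussWeight v y * (Ioi (√s)).indicator (fun _ => 1) y) =
      (Ioi (√s)).indicator (fun y => y ^ (2 * d - 1) * gaussWeight v y) y := by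
    intro y
    by_cases h : y ∈ Ioi (√s)
    · rw [indicator_of_mem h, indicator_of_mem h, mul_one]
    · rw [indicator_of_notMem h, indicator_of_notMem h, mul_zero, mul_zero]
  have e5 : ∫ y in Ioi (0 : ℝ), (Ioi (√s)).indicator (fun y => y ^ (2 * d - 1) * gaussWeight v y) y
      = κ * poissonTail d (s / (2 * v)) := by
    rw [setIntegral_indicator measurableSet_Ioi, Ioi_inter_Ioi, max_eq_right (Real.sqrt_nonneg s),
      htail _ (Real.sqrt_nonneg s), Real.sq_sqrt hs]
  simp_rw [e3, e4] at hind
  rw [e5, integral_indicator hmS, integral_const, smul_eq_mul, mul_one,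
    measureReal_restrict_apply_univ] at hind
  rw [hind, ← mul_assoc]
  have h0 : poissonTail d ((0 : ℝ) ^ 2 / (2 * v)) = 1 := by
    rw [show (0 : ℝ) ^ 2 / (2 * v) = 0 by simp, poissonTail_zero hd]
  rw [h0, mul_one] at htot
  rw [← htot, one_mul]

lemma IsotropicGaussian.measure_norm_sq_eq {v : ℝ} (hv : 0 < v) [Nontrivial V] {ν : Measure V}
    [IsProbabilityMeasure ν] (hν : IsotropicGaussian v ν) (c : ℝ) :
    ν {x | ‖x‖ ^ 2 = c} = 0 := by
  have hac : ν ≪ volume := by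
    rw [hν.eq_withDensity hv]; exact withDensity_absolutelyContinuous _ _
  refine hac (measure_mono_null (fun x hx => ?_) (Measure.addHaar_sphere volume (0 : V) (√c)))
  have hx' : ‖x‖ ^ 2 = c := hx
  rw [mem_sphere_zero_iff_norm, ← hx', Real.sqrt_sq (norm_nonneg x)]

lemma IsotropicGaussian.map_orthogonalProjectionOnto {v : ℝ} {ν : Measure V}
    (hν : IsotropicGaussian v ν) (W : Submodule ℝ V) :
    IsotropicGaussian v (ν.map W.orthogonalProjectionOnto) := by
  intro t
  rw [charFun_apply, integral_map (by fun_prop) (by fun_prop)]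
  have := hν (t : V)
  rw [charFun_apply] at this
  simpa using this

/-- The component of an isotropic Gaussian vector in a subspace is independent of the component
in the orthogonal complement. -/
lemma IsotropicGaussian.indepFun_starProjection {v : ℝ} {ν : Measure V} [IsProbabilityMeasure ν]
    (hν : IsotropicGaussian v ν) (W : Submodule ℝ V) :
    IndepFun (fun x => W.starProjection x) (fun x => x - W.starProjection x) ν := by
  rw [indepFun_iff_charFun_prod (by fun_prop) (by fun_prop)]
  intro t
  have hm1 : AEMeasurable (fun x => W.starProjection x) ν := by fun_prop
  have hm2 : AEMeasurable (fun x => x - W.starProjection x) ν := by fun_prop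
  rw [charFun_apply, charFun_apply, charFun_apply, integral_map (by fun_prop) (by fun_prop),
    integral_map hm1 (by fun_prop), integral_map hm2 (by fun_prop)]
  set a := t.ofLp.1
  set b := t.ofLp.2
  have h1 : ∀ x : V, inner ℝ (W.starProjection x) a = inner ℝ x (W.starProjection a) := fun x =>
    Submodule.inner_starProjection_left_eq_right W x a
  have h2 : ∀ x : V, inner ℝ (x - W.starProjection x) b = inner ℝ x (b - W.starProjection b) := by
    intro x
    rw [inner_sub_left, inner_sub_right, Submodule.inner_starProjection_left_eq_right]
  have h3 : ∀ x : V, inner ℝ (WithLp.toLp 2 (W.starProjection x, x - W.starProjection x)) t =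
      inner ℝ x (W.starProjection a + (b - W.starProjection b)) := by
    intro x
    rw [WithLp.prod_inner_apply, inner_add_right, ← h1, ← h2]
  simp_rw [h1, h2, h3]
  have k := fun y => (charFun_apply (μ := ν) y).symm.trans (hν y)
  rw [k, k, k, ← Complex.exp_add]
  congr 1
  -- Pythagoras makes the exponent additive, so the joint characteristic function factors.
  have horth : inner ℝ (W.starProjection a) (b - W.starProjection b) = 0 :=
    (Submodule.mem_orthogonal W _).1 (W.sub_starProjection_mem_orthogonal b) _
      (W.starProjection_apply_mem a)
  have hpy := norm_add_sq_eq_norm_sq_add_norm_sq_of_inner_eq_zero _ _ horth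
  have hpy' : ‖W.starProjection a + (b - W.starProjection b)‖ ^ 2 =
      ‖W.starProjection a‖ ^ 2 + ‖b - W.starProjection b‖ ^ 2 := by
    simpa [sq] using hpy
  have hpyc : (‖W.starProjection a + (b - W.starProjection b)‖ : ℂ) ^ 2 =
      (‖W.starProjection a‖ : ℂ) ^ 2 + (‖b - W.starProjection b‖ : ℂ) ^ 2 := by
    exact_mod_cast hpy'
  rw [hpyc]
  ring

end Isotropic

/-! ### Association and correlation for nested subspaces -/

/-- Chebyshev's association inequality for a decreasing event and a lower half-line. -/
lemma prod_measure_inter_ge {Y : Type*} [MeasurableSpace Y] (ρ : Measure ℝ)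
    [IsProbabilityMeasure ρ] (η : Measure Y) [IsProbabilityMeasure η] {D : Set (ℝ × Y)}
    (hD : MeasurableSet D) (hmono : ∀ a b y, b ≤ a → (a, y) ∈ D → (b, y) ∈ D) (t : ℝ) :
    (ρ.prod η) D * ρ (Iic t) ≤ (ρ.prod η) (D ∩ Iic t ×ˢ univ) := by
  let g : ℝ → ENNReal := fun a => η (Prod.mk a ⁻¹' D)
  have hg : Measurable g := measurable_measure_prodMk_left hD
  have hanti : Antitone g := fun b a hba => measure_mono fun y hy => hmono a b y hba hy
  have h1 : (ρ.prod η) D = ∫⁻ a, g a ∂ρ := Measure.prod_apply hD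
  have h2 : (ρ.prod η) (D ∩ Iic t ×ˢ univ) = ∫⁻ a in Iic t, g a ∂ρ := by
    rw [Measure.prod_apply (hD.inter (measurableSet_Iic.prod MeasurableSet.univ)),
      ← lintegral_indicator measurableSet_Iic]
    refine lintegral_congr fun a => ?_
    by_cases ha : a ∈ Iic t
    · rw [indicator_of_mem ha]
      congr 1
      ext y
      simp only [mem_preimage, mem_inter_iff, mem_prod, mem_univ, and_true]
      exact ⟨fun h => h.1, fun h => ⟨h, ha⟩⟩
    · rw [indicator_of_notMem ha]
      convert measure_empty (μ := η)
      ext y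
      simp only [mem_preimage, mem_inter_iff, mem_prod, mem_univ, and_true, mem_empty_iff_false,
        iff_false]
      exact fun h => ha h.2
  rw [h1, h2]
  set I := ∫⁻ a in Iic t, g a ∂ρ
  set J := ∫⁻ a in (Iic t)ᶜ, g a ∂ρ
  -- The section measure `g` is at least `g t` below `t` and at most `g t` above; comparing both
  -- parts with `g t` gives the inequality.
  have hsplit : ∫⁻ a, g a ∂ρ = I + J := (lintegral_add_compl g measurableSet_Iic).symm
  have hI : g t * ρ (Iic t) ≤ I := by
    rw [← setLIntegral_const]
    exact setLIntegral_mono' measurableSet_Iic fun a ha => hanti ha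
  have hJ : J ≤ g t * ρ (Iic t)ᶜ := by
    rw [← setLIntegral_const]
    refine setLIntegral_mono' measurableSet_Iic.compl fun a ha => hanti ?_
    exact le_of_lt (not_le.1 ha)
  have hone : ρ (Iic t) + ρ (Iic t)ᶜ = 1 := by
    rw [measure_add_measure_compl measurableSet_Iic, measure_univ]
  calc (∫⁻ a, g a ∂ρ) * ρ (Iic t) = I * ρ (Iic t) + J * ρ (Iic t) := by rw [hsplit, add_mul]
    _ ≤ I * ρ (Iic t) + g t * ρ (Iic t)ᶜ * ρ (Iic t) := by gcongr
    _ = I * ρ (Iic t) + g t * ρ (Iic t) * ρ (Iic t)ᶜ := by ring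
    _ ≤ I * ρ (Iic t) + I * ρ (Iic t)ᶜ := by gcongr
    _ = I := by rw [← mul_add, hone, mul_one]

section Nested

lemma norm_sq_starProjection_of_le {V : Type*} [NormedAddCommGroup V] [InnerProductSpace ℝ V]
    [FiniteDimensional ℝ V] {W W' : Submodule ℝ V} (h : W ≤ W') (x : V) :
    ‖W'.starProjection x‖ ^ 2 =
      ‖W.starProjection x‖ ^ 2 + ‖W'.starProjection (x - W.starProjection x)‖ ^ 2 := by
  have hmem : W.starProjection x ∈ W' := h (W.starProjection_apply_mem x)
  have h1 : W'.starProjection (W.starProjection x) = W.starProjection x :=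
    Submodule.starProjection_eq_self_iff.2 hmem
  have h2 : W'.starProjection x =
      W.starProjection x + W'.starProjection (x - W.starProjection x) := by
    rw [map_sub, h1]; abel
  have horth : inner ℝ (W.starProjection x) (W'.starProjection (x - W.starProjection x)) = 0 := by
    rw [← Submodule.inner_starProjection_left_eq_right, h1]
    exact (Submodule.mem_orthogonal W _).1 (W.sub_starProjection_mem_orthogonal x) _
      (W.starProjection_apply_mem x)
  have hpy := norm_add_sq_eq_norm_sq_add_norm_sq_of_inner_eq_zero _ _ horth
  rw [h2]
  simpa [sq] using hpy

variable {V : Type*} [NormedAddCommGroup V] [InnerProductSpace ℝ V] [FiniteDimensional ℝ V]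
  [MeasurableSpace V] [BorelSpace V]

/-- Gaussian correlation inequality for bounds on the projections to nested subspaces. -/
lemma IsotropicGaussian.measure_inter_ge {v : ℝ} {ν : Measure V} [IsProbabilityMeasure ν]
    (hν : IsotropicGaussian v ν) {ι : Type*} [Countable ι] (W : Submodule ℝ V)
    (W' : ι → Submodule ℝ V) (hW : ∀ m, W ≤ W' m) (s : ι → ℝ) (t : ℝ) :
    ν {x | ∀ m, ‖(W' m).starProjection x‖ ^ 2 ≤ s m} * ν {x | ‖W.starProjection x‖ ^ 2 ≤ t} ≤
      ν {x | (∀ m, ‖(W' m).starProjection x‖ ^ 2 ≤ s m) ∧ ‖W.starProjection x‖ ^ 2 ≤ t} := by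
  have hind : IndepFun (fun x => ‖W.starProjection x‖ ^ 2) (fun x => x - W.starProjection x) ν :=
    (hν.indepFun_starProjection W).comp (φ := fun y => ‖y‖ ^ 2) (ψ := id)
      (by fun_prop) measurable_id
  have hm1 : Measurable (fun x : V => ‖W.starProjection x‖ ^ 2) := by fun_prop
  have hm2 : Measurable (fun x : V => x - W.starProjection x) := by fun_prop
  have hm := hm1.prodMk hm2
  rw [indepFun_iff_map_prod_eq_prod_map_map hm1.aemeasurable hm2.aemeasurable] at hind
  -- By Pythagoras each constraint is additive in the squared norm of the `W`-component and a
  -- function of the independent remainder, so `D` is a lower set in its first coordinate.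
  let D : Set (ℝ × V) := {p | ∀ m, p.1 + ‖(W' m).starProjection p.2‖ ^ 2 ≤ s m}
  have hD : MeasurableSet D := by
    simp only [D, ofPred_forall]
    exact MeasurableSet.iInter fun m => measurableSet_le (by fun_prop) measurable_const
  have := Measure.isProbabilityMeasure_map (μ := ν) hm1.aemeasurable
  have := Measure.isProbabilityMeasure_map (μ := ν) hm2.aemeasurable
  have key := prod_measure_inter_ge (ν.map fun x => ‖W.starProjection x‖ ^ 2)
    (ν.map fun x => x - W.starProjection x) hD
    (fun a b y hba h m => le_trans (by gcongr) (h m)) t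
  rw [← hind, Measure.map_apply hm hD, Measure.map_apply hm1 measurableSet_Iic,
    Measure.map_apply hm (hD.inter (measurableSet_Iic.prod MeasurableSet.univ))] at key
  have e : ∀ x, (∀ m, ‖(W' m).starProjection x‖ ^ 2 ≤ s m) ↔
      (‖W.starProjection x‖ ^ 2, x - W.starProjection x) ∈ D := by
    intro x
    exact forall_congr' fun m => by rw [norm_sq_starProjection_of_le (hW m) x]
  have e1 : {x | ∀ m, ‖(W' m).starProjection x‖ ^ 2 ≤ s m} =
      (fun x => (‖W.starProjection x‖ ^ 2, x - W.starProjection x)) ⁻¹' D := by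
    ext x; exact e x
  have e2 : {x | (∀ m, ‖(W' m).starProjection x‖ ^ 2 ≤ s m) ∧ ‖W.starProjection x‖ ^ 2 ≤ t} =
      (fun x => (‖W.starProjection x‖ ^ 2, x - W.starProjection x)) ⁻¹' (D ∩ Iic t ×ˢ univ) := by
    ext x
    simp only [mem_ofPred_eq, mem_preimage, mem_inter_iff, mem_prod, mem_univ, and_true, mem_Iic]
    rw [e x]
  rw [e1, e2]
  exact key

end Nested

/-! ### Projected gains of one Gaussian vector -/

section ZfGain

variable {r : ℕ}

lemma zfGain_nonneg (S : Set (EuclideanSpace ℂ (Fin r))) (x : EuclideanSpace ℂ (Fin r)) :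
    0 ≤ zfGain S x := sq_nonneg _

/-- The real subspace underlying the orthogonal complement of the span of `S`. -/
noncomputable def nullSpace (S : Set (EuclideanSpace ℂ (Fin r))) :
    Submodule ℝ (EuclideanSpace ℂ (Fin r)) :=
  ((Submodule.span ℂ S)ᗮ).restrictScalars ℝ

lemma real_inner_eq_re (x y : EuclideanSpace ℂ (Fin r)) :
    (inner ℝ x y : ℝ) = (inner ℂ x y : ℂ).re := by
  rw [PiLp.inner_apply, PiLp.inner_apply, Complex.re_sum]
  rfl

lemma starProjection_nullSpace (S : Set (EuclideanSpace ℂ (Fin r)))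
    (x : EuclideanSpace ℂ (Fin r)) :
    (nullSpace S).starProjection x = (Submodule.span ℂ S)ᗮ.starProjection x := by
  set U := (Submodule.span ℂ S)ᗮ
  refine Submodule.eq_starProjection_of_mem_of_inner_eq_zero (U.starProjection_apply_mem x) ?_
  intro w hw
  have hw' : w ∈ U := hw
  rw [real_inner_eq_re, (Submodule.mem_orthogonal' U _).1 (U.sub_starProjection_mem_orthogonal x)
    w hw', Complex.zero_re]

lemma zfGain_eq (S : Set (EuclideanSpace ℂ (Fin r))) (x : EuclideanSpace ℂ (Fin r)) :
    zfGain S x = ‖(nullSpace S).starProjection x‖ ^ 2 := by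
  rw [zfGain, starProjection_nullSpace]

lemma finrank_nullSpace {S : Set (EuclideanSpace ℂ (Fin r))} {k : ℕ}
    (hk : Module.finrank ℂ (Submodule.span ℂ S) = k) :
    Module.finrank ℝ (nullSpace S) = 2 * (r - k) := by
  have h1 := (Submodule.span ℂ S).finrank_add_finrank_orthogonal
  rw [finrank_euclideanSpace_fin, hk] at h1
  have h2 : Module.finrank ℝ (nullSpace S) = 2 * Module.finrank ℂ ((Submodule.span ℂ S)ᗮ :) :=
    finrank_real_of_complex ((Submodule.span ℂ S)ᗮ :)
  omega

variable {v : ℝ} {ν : Measure (EuclideanSpace ℂ (Fin r))} [IsProbabilityMeasure ν]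

lemma IsotropicGaussian.measure_zfGain_le (hv : 0 < v) (hν : IsotropicGaussian v ν)
    {S : Set (EuclideanSpace ℂ (Fin r))} {k : ℕ} (hkr : k < r)
    (hk : Module.finrank ℂ (Submodule.span ℂ S) = k) {t : ℝ} (ht : 0 ≤ t) :
    ν {x | zfGain S x ≤ t} = ENNReal.ofReal (1 - poissonTail (r - k) (t / (2 * v))) := by
  have hm : Measurable (nullSpace S).orthogonalProjectionOnto := by fun_prop
  have := Measure.isProbabilityMeasure_map (μ := ν) hm.aemeasurable
  have h1 := (hν.map_orthogonalProjectionOnto (nullSpace S)).measureReal_norm_sq_gt hv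
    (d := r - k) (by omega) (finrank_nullSpace hk) ht
  have hset : MeasurableSet {y : nullSpace S | t < ‖y‖ ^ 2} :=
    measurableSet_lt measurable_const (by fun_prop)
  rw [map_measureReal_apply hm hset] at h1
  have e : {x | zfGain S x ≤ t} =
      ((nullSpace S).orthogonalProjectionOnto ⁻¹' {y | t < ‖y‖ ^ 2})ᶜ := by
    ext x
    simp only [mem_ofPred_eq, mem_compl_iff, mem_preimage, not_lt, zfGain_eq]
    rfl
  rw [← ofReal_measureReal, e, probReal_compl_eq_one_sub (hm hset), h1]

lemma IsotropicGaussian.measure_zfGain_eq (hv : 0 < v) (hν : IsotropicGaussian v ν)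
    {S : Set (EuclideanSpace ℂ (Fin r))}
    (hk : Module.finrank ℂ (Submodule.span ℂ S) < r) (c : ℝ) :
    ν {x | zfGain S x = c} = 0 := by
  have hm : Measurable (nullSpace S).orthogonalProjectionOnto := by fun_prop
  have := Measure.isProbabilityMeasure_map (μ := ν) hm.aemeasurable
  have : Nontrivial (nullSpace S) := by
    refine Module.nontrivial_of_finrank_pos (R := ℝ) ?_
    rw [finrank_nullSpace rfl]
    omega
  have h1 := (hν.map_orthogonalProjectionOnto (nullSpace S)).measure_norm_sq_eq hv c
  have hset : MeasurableSet {y : nullSpace S | ‖y‖ ^ 2 = c} :=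
    measurableSet_eq_fun (by fun_prop) measurable_const
  rw [Measure.map_apply hm hset] at h1
  convert h1 using 2
  ext x
  simp only [mem_ofPred_eq, mem_preimage, zfGain_eq]
  rfl

lemma IsotropicGaussian.measure_zfGain_inter_ge (hν : IsotropicGaussian v ν) {ι : Type*}
    [Countable ι] (S : Set (EuclideanSpace ℂ (Fin r)))
    (S' : ι → Set (EuclideanSpace ℂ (Fin r))) (hS : ∀ m, S' m ⊆ S) (s : ι → ℝ) (t : ℝ) :
    ν {x | ∀ m, zfGain (S' m) x ≤ s m} * ν {x | zfGain S x ≤ t} ≤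
      ν {x | (∀ m, zfGain (S' m) x ≤ s m) ∧ zfGain S x ≤ t} := by
  simp_rw [zfGain_eq]
  exact hν.measure_inter_ge (nullSpace S) (fun m => nullSpace (S' m))
    (fun m => Submodule.orthogonal_le (Submodule.span_mono (hS m))) s t

end ZfGain

/-! ### Greedy selection on product measures -/

section Configurations

variable {r K : ℕ}

lemma zfGain_eq_zero_of_mem_span {S : Set (EuclideanSpace ℂ (Fin r))}
    {x : EuclideanSpace ℂ (Fin r)} (hx : x ∈ Submodule.span ℂ S) : zfGain S x = 0 := by
  have : (Submodule.span ℂ S)ᗮ.starProjection x = 0 := by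
    rw [Submodule.starProjection_orthogonal_val, Submodule.starProjection_eq_self_iff.2 hx,
      sub_self]
  rw [zfGain, this]
  simp

/-- The gain is the squared distance to the span, attained by some linear combination. Projection
onto a varying span is not continuous in the spanning vectors, but this form exhibits strict
sublevel sets as unions of open sets, hence measurability. -/
lemma zfGain_lt_iff {ι : Type*} (T : Finset ι) (f : ι → EuclideanSpace ℂ (Fin r))
    (y : EuclideanSpace ℂ (Fin r)) (c : ℝ) :
    zfGain (f '' T) y < c ↔ ∃ a : ι → ℂ, ‖y - ∑ m ∈ T, a m • f m‖ ^ 2 < c := by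
  classical
  set U := Submodule.span ℂ (f '' T) with hU
  have hP : ∀ x, Uᗮ.starProjection x = x - U.starProjection x :=
    U.starProjection_orthogonal_val
  constructor
  · intro h
    obtain ⟨a, ha⟩ := (Submodule.mem_span_image_finset_iff_exists_fun ℂ).1
      (U.starProjection_apply_mem y)
    refine ⟨fun m => if hm : m ∈ T then a ⟨m, hm⟩ else 0, ?_⟩
    have e : ∑ m ∈ T, (if hm : m ∈ T then a ⟨m, hm⟩ else 0) • f m = U.starProjection y := by
      rw [← ha, ← Finset.sum_coe_sort]
      exact Finset.sum_congr rfl fun m _ => by rw [dif_pos m.2]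
    rw [e, ← hP]
    exact h
  · rintro ⟨a, ha⟩
    refine lt_of_le_of_lt ?_ ha
    have hw : ∑ m ∈ T, a m • f m ∈ U :=
      Submodule.sum_mem _ fun m hm => Submodule.smul_mem _ _
        (Submodule.subset_span (mem_image_of_mem f hm))
    have e : Uᗮ.starProjection y = Uᗮ.starProjection (y - ∑ m ∈ T, a m • f m) := by
      rw [map_sub, hP (∑ m ∈ T, a m • f m), Submodule.starProjection_eq_self_iff.2 hw, sub_self,
        sub_zero]
    change ‖Uᗮ.starProjection y‖ ^ 2 ≤ _
    rw [e]
    exact pow_le_pow_left₀ (norm_nonneg _) (Submodule.norm_starProjection_apply_le _ _) 2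

lemma announced_eq_image_finset (x : Fin K → EuclideanSpace ℂ (Fin r)) (s : Fin r → Fin K)
    (l : Fin r) : announced x s l = (fun m => x (s m)) '' (Finset.Iio l : Finset (Fin r)) := by
  rw [announced, Finset.coe_Iio]

lemma measurable_zfGain_announced (s : Fin r → Fin K) (l : Fin r) (j : Fin K) :
    Measurable fun x : Fin K → EuclideanSpace ℂ (Fin r) => zfGain (announced x s l) (x j) := by
  refine measurable_of_Iio fun c => IsOpen.measurableSet ?_
  have : (fun x : Fin K → EuclideanSpace ℂ (Fin r) => zfGain (announced x s l) (x j)) ⁻¹' Iio c =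
      ⋃ a : Fin r → ℂ, {x | ‖x j - ∑ m ∈ Finset.Iio l, a m • x (s m)‖ ^ 2 < c} := by
    ext x
    simp only [mem_preimage, mem_Iio, mem_iUnion, mem_ofPred_eq]
    rw [announced_eq_image_finset, zfGain_lt_iff]
  rw [this]
  refine isOpen_iUnion fun a => isOpen_lt ?_ continuous_const
  fun_prop

lemma announced_mono (x : Fin K → EuclideanSpace ℂ (Fin r)) (s : Fin r → Fin K) {m l : Fin r}
    (h : m ≤ l) : announced x s m ⊆ announced x s l :=
  image_mono (Iio_subset_Iio h)

lemma announced_congr {x x' : Fin K → EuclideanSpace ℂ (Fin r)} {s s' : Fin r → Fin K}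
    {l : Fin r} (h : ∀ m < l, x (s m) = x' (s' m)) : announced x s l = announced x' s' l :=
  image_congr fun m hm => h m hm

lemma remaining_congr {s s' : Fin r → Fin K} {l : Fin r} (h : ∀ m < l, s m = s' m) :
    remaining s l = remaining s' l := by
  ext i
  exact forall₂_congr fun m hm => by rw [h m hm]

lemma remaining_anti (s : Fin r → Fin K) {m l : Fin r} (h : m ≤ l) :
    remaining s l ⊆ remaining s m := fun _ hi k hk => hi k (hk.trans_le h)

lemma finrank_span_announced_lt (x : Fin K → EuclideanSpace ℂ (Fin r)) (s : Fin r → Fin K)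
    (l : Fin r) : Module.finrank ℂ (Submodule.span ℂ (announced x s l)) < r := by
  have h := finrank_range_le_card (R := ℂ) (fun m : Iio l => x (s m))
  have e : announced x s l = range (fun m : Iio l => x (s m)) := by
    rw [announced, image_eq_range]
  rw [Set.finrank, ← e] at h
  have : Fintype.card (Iio l) = l := by simp
  omega

/-- A nonzero gain means that the new vector lies outside the span of the earlier ones, so the
family stays linearly independent. This fixes the Gamma shape `r - l`. -/
lemma finrank_span_announced {x : Fin K → EuclideanSpace ℂ (Fin r)} {s : Fin r → Fin K}
    {l : Fin r} (h : ∀ m < l, zfGain (announced x s m) (x (s m)) ≠ 0) :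
    Module.finrank ℂ (Submodule.span ℂ (announced x s l)) = l := by
  have hli : ∀ n : ℕ, n ≤ l →
      LinearIndepOn ℂ (fun m => x (s m)) {m : Fin r | (m : ℕ) < n} := by
    intro n
    induction n with
    | zero => intro _; simp
    | succ n ih =>
      intro hn
      have hnr : n < r := by omega
      have e : {m : Fin r | (m : ℕ) < n + 1} = insert ⟨n, hnr⟩ {m : Fin r | (m : ℕ) < n} := by
        ext m
        simp only [mem_ofPred_eq, mem_insert_iff, Fin.ext_iff]
        omega
      rw [e, linearIndepOn_insert (by simp)]
      refine ⟨ih (by omega), fun hmem => ?_⟩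
      exact h ⟨n, hnr⟩ (Fin.lt_def.2 (by simpa using hn)) (zfGain_eq_zero_of_mem_span hmem)
  have h1 : LinearIndepOn ℂ (fun m => x (s m)) (Iio l) := hli l le_rfl
  have h2 := finrank_span_eq_card h1
  have e : announced x s l = range (fun m : Iio l => x (s m)) := by
    rw [announced, image_eq_range]
  rw [e, h2]
  simp

/-- Users outside a nonempty contending set lie at or below the threshold, hence below the winner.
-/
lemma IsSICRun.isGreedy {u : Fin r → ℝ} {x : Fin K → EuclideanSpace ℂ (Fin r)}
    {sel : Fin r → Fin K} (h : IsSICRun u x sel) (l : Fin r) :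
    sel l ∈ remaining sel l ∧ ∀ i ∈ remaining sel l,
      zfGain (announced x sel l) (x i) ≤ zfGain (announced x sel l) (x (sel l)) := by
  obtain ⟨h1, h2⟩ := h l
  unfold contenders at h1 h2
  split_ifs at h1 h2 with hne
  · refine ⟨h1.1, fun i hi => ?_⟩
    by_cases hiu : u l < zfGain (announced x sel l) (x i)
    · exact h2 i ⟨hi, hiu⟩
    · exact (not_lt.1 hiu).trans h1.2.le
  · exact ⟨h1, h2⟩

/-- Configurations without ties and without degenerate channel vectors. -/
def regularConfigs (r K : ℕ) : Set (Fin K → EuclideanSpace ℂ (Fin r)) :=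
  {x | ∀ (s : Fin r → Fin K) (m : Fin r), ∀ i ∈ remaining s m,
    zfGain (announced x s m) (x i) ≠ 0 ∧
      ∀ j ≠ i, zfGain (announced x s m) (x i) ≠ zfGain (announced x s m) (x j)}

/-- Configurations whose greedy selection starts with the users `s m`, `m < l`. -/
def greedyPrefix (s : Fin r → Fin K) (l : Fin r) : Set (Fin K → EuclideanSpace ℂ (Fin r)) :=
  {x | ∀ m < l, ∀ j ∈ remaining s m,
    zfGain (announced x s m) (x j) ≤ zfGain (announced x s m) (x (s m))}

/-- Configurations in which all users that remain after the users `s m`, `m < l`, have a projected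
gain of at most `t`. -/
def remainingGainLE (s : Fin r → Fin K) (l : Fin r) (t : ℝ) :
    Set (Fin K → EuclideanSpace ℂ (Fin r)) :=
  {x | ∀ j ∈ remaining s l, zfGain (announced x s l) (x j) ≤ t}

/-- Configurations in which the vectors of the users `s m`, `m < l`, are linearly independent. -/
def nondegenerate (s : Fin r → Fin K) (l : Fin r) : Set (Fin K → EuclideanSpace ℂ (Fin r)) :=
  {x | ∀ m < l, zfGain (announced x s m) (x (s m)) ≠ 0}

lemma measurableSet_greedyPrefix (s : Fin r → Fin K) (l : Fin r) :
    MeasurableSet (greedyPrefix s l) := by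
  simp only [greedyPrefix, ofPred_forall]
  exact MeasurableSet.iInter fun m => MeasurableSet.iInter fun _ => MeasurableSet.iInter fun j =>
    MeasurableSet.iInter fun _ => measurableSet_le (measurable_zfGain_announced s m j)
      (measurable_zfGain_announced s m (s m))

lemma measurableSet_remainingGainLE (s : Fin r → Fin K) (l : Fin r) (t : ℝ) :
    MeasurableSet (remainingGainLE s l t) := by
  simp only [remainingGainLE, ofPred_forall]
  exact MeasurableSet.iInter fun j => MeasurableSet.iInter fun _ =>
    measurableSet_le (measurable_zfGain_announced s l j) measurable_const

lemma measurableSet_nondegenerate (s : Fin r → Fin K) (l : Fin r) :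
    MeasurableSet (nondegenerate s l) := by
  simp only [nondegenerate, ofPred_forall]
  exact MeasurableSet.iInter fun m => MeasurableSet.iInter fun _ =>
    (measurableSet_eq_fun (measurable_zfGain_announced s m (s m)) measurable_const).compl

/-- As long as the two schedules agree, both next users maximize the same gain; without ties the
maximizer is unique. -/
lemma IsSICRun.eq_of_mem_greedyPrefix {u : Fin r → ℝ} {x : Fin K → EuclideanSpace ℂ (Fin r)}
    {sel : Fin r → Fin K} (h : IsSICRun u x sel) (hx : x ∈ regularConfigs r K)
    {s : Fin r → Fin K} {l : Fin r} (hs : ∀ m < l, s m ∈ remaining s m)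
    (hxs : x ∈ greedyPrefix s l) : ∀ m < l, sel m = s m := by
  intro m
  induction m using WellFoundedLT.induction with
  | _ m ih =>
    intro hm
    have hlt : ∀ k < m, sel k = s k := fun k hk => ih k hk (hk.trans hm)
    have hrem : remaining sel m = remaining s m := remaining_congr hlt
    have hann : announced x sel m = announced x s m :=
      announced_congr fun k hk => by rw [hlt k hk]
    obtain ⟨h1, h2⟩ := h.isGreedy m
    rw [hrem] at h1 h2
    rw [hann] at h2
    by_contra hne
    exact (hx s m (sel m) h1).2 (s m) (Ne.symm hne)
      (le_antisymm (hxs m hm _ h1) (h2 _ (hs m hm)))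

variable {v : ℝ} {ν : Measure (EuclideanSpace ℂ (Fin r))} [IsProbabilityMeasure ν]

/-- Fubini: it suffices that every section in the coordinate `i` is null. -/
lemma measure_pi_eq_zero_of_update {N : Set (Fin K → EuclideanSpace ℂ (Fin r))}
    (hN : MeasurableSet N) (i : Fin K) (h : ∀ x, ν {y | Function.update x i y ∈ N} = 0) :
    Measure.pi (fun _ : Fin K => ν) N = 0 := by
  have hf : Measurable (N.indicator fun _ => (1 : ENNReal)) := measurable_const.indicator hN
  have key := lintegral_le_of_lmarginal_le (μ := fun _ : Fin K => ν) {i} hf measurable_zero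
    (fun x => by
      rw [lmarginal_singleton]
      have e : ∀ y, N.indicator (fun _ => (1 : ENNReal)) (Function.update x i y) =
          {y | Function.update x i y ∈ N}.indicator (fun _ => 1) y := fun y => rfl
      have hm : MeasurableSet {y | Function.update x i y ∈ N} :=
        (measurable_update x) hN
      simp_rw [e]
      rw [lintegral_indicator hm, setLIntegral_const, h x]
      simp)
  rw [lintegral_indicator hN] at key
  simpa using key

lemma announced_update {x : Fin K → EuclideanSpace ℂ (Fin r)} {s : Fin r → Fin K} {m : Fin r}
    {i : Fin K} (hi : i ∈ remaining s m) (y : EuclideanSpace ℂ (Fin r)) :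
    announced (Function.update x i y) s m = announced x s m :=
  announced_congr fun k hk => Function.update_of_ne (hi k hk) _ _

/-- Resample a remaining user with all other vectors fixed: the announced set does not move, and
neither 0 nor the gain of another user is an atom of the new gain, since fewer than `r` announced
vectors leave a nontrivial null space. -/
lemma ae_mem_regularConfigs (hv : 0 < v) (hν : IsotropicGaussian v ν) :
    ∀ᵐ x ∂Measure.pi (fun _ : Fin K => ν), x ∈ regularConfigs r K := by
  simp only [regularConfigs, mem_ofPred_eq]
  rw [ae_all_iff]; intro s
  rw [ae_all_iff]; intro m
  rw [ae_all_iff]; intro i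
  rw [ae_all_iff]; intro hi
  refine Eventually.and ?_ ?_
  · rw [ae_iff]
    simp only [not_not, ne_eq]
    refine measure_pi_eq_zero_of_update
      (measurableSet_eq_fun (measurable_zfGain_announced s m i) measurable_const) i fun x => ?_
    simp only [mem_ofPred_eq, announced_update hi, Function.update_self]
    exact hν.measure_zfGain_eq hv (finrank_span_announced_lt x s m) 0
  · rw [ae_all_iff]; intro j
    rw [ae_all_iff]; intro hj
    rw [ae_iff]
    simp only [not_not, ne_eq]
    refine measure_pi_eq_zero_of_update
      (measurableSet_eq_fun (measurable_zfGain_announced s m i)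
        (measurable_zfGain_announced s m j)) i fun x => ?_
    simp only [mem_ofPred_eq, announced_update hi, Function.update_self,
      Function.update_of_ne hj]
    exact hν.measure_zfGain_eq hv (finrank_span_announced_lt x s m) _

/-- Given the first users, bounds on the projected gains of the remaining users are positively
correlated with the event that these users were not selected. -/
lemma measure_pi_greedyPrefix_mul_le (hv : 0 < v) (hν : IsotropicGaussian v ν)
    (s : Fin r → Fin K) (l : Fin r) {t : ℝ} (ht : 0 ≤ t) :
    ENNReal.ofReal ((1 - poissonTail (r - l) (t / (2 * v))) ^ K) *
        Measure.pi (fun _ : Fin K => ν) (greedyPrefix s l ∩ nondegenerate s l) ≤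
      Measure.pi (fun _ : Fin K => ν) (greedyPrefix s l ∩ remainingGainLE s l t) := by
  classical
  set p := 1 - poissonTail (r - l) (t / (2 * v)) with hp
  have hd : 1 ≤ r - (l : ℕ) := by omega
  have hp0 : 0 ≤ p := sub_nonneg.2 (poissonTail_le_one hd (by positivity))
  have hp1 : p ≤ 1 := by
    have := poissonTail_pos hd (x := t / (2 * v)) (by positivity)
    linarith
  -- Only the vectors of the remaining users are integrated out; the announced vectors stay fixed at
  -- those of `x`.
  set J : Finset (Fin K) := Finset.univ.filter (· ∈ remaining s l) with hJ
  have hJmem : ∀ j, j ∈ J ↔ j ∈ remaining s l := fun j => by simp [hJ]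
  have hA := measurableSet_greedyPrefix s l
  have hB := measurableSet_remainingGainLE s l t
  have hR := measurableSet_nondegenerate s l
  set c := ENNReal.ofReal (p ^ K)
  have hf : Measurable ((greedyPrefix s l ∩ nondegenerate s l).indicator fun _ => c) :=
    measurable_const.indicator (hA.inter hR)
  have hg : Measurable ((greedyPrefix s l ∩ remainingGainLE s l t).indicator
    fun _ => (1 : ENNReal)) := measurable_const.indicator (hA.inter hB)
  have key := lintegral_le_of_lmarginal_le (μ := fun _ : Fin K => ν) J hf hg (fun x => ?_)
  · rwa [lintegral_indicator (hA.inter hR), setLIntegral_const,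
      lintegral_indicator (hA.inter hB), setLIntegral_const, one_mul] at key
  rw [lmarginal, lmarginal]
  have hupd : ∀ (y : J → EuclideanSpace ℂ (Fin r)), ∀ m < l,
      Function.updateFinset x J y (s m) = x (s m) := by
    intro y m hm
    rw [Function.updateFinset, dif_neg]
    rw [hJmem]
    exact fun h => h m hm rfl
  have hann : ∀ (y : J → EuclideanSpace ℂ (Fin r)), ∀ m ≤ l,
      announced (Function.updateFinset x J y) s m = announced x s m := fun y m hm =>
    announced_congr fun k hk => hupd y k (hk.trans_le hm)
  -- `C` collects the comparisons among the scheduled users, which do not involve the integrated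
  -- coordinates. All other constraints split into one copy of `D` or `D'` per remaining user.
  let C : Prop := (∀ m < l, ∀ j ∈ remaining s m, j ∉ J →
    zfGain (announced x s m) (x j) ≤ zfGain (announced x s m) (x (s m)))
  let D : Set (EuclideanSpace ℂ (Fin r)) := {y | ∀ m : Iio l,
    zfGain (announced x s m) y ≤ zfGain (announced x s m) (x (s m))}
  let D' : Set (EuclideanSpace ℂ (Fin r)) := {y | (∀ m : Iio l,
    zfGain (announced x s m) y ≤ zfGain (announced x s m) (x (s m))) ∧
      zfGain (announced x s l) y ≤ t}
  have hAiff : ∀ y : J → EuclideanSpace ℂ (Fin r),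
      Function.updateFinset x J y ∈ greedyPrefix s l ↔ C ∧ y ∈ Set.pi univ fun _ => D := by
    intro y
    constructor
    · intro h
      refine ⟨fun m hm j hj hjJ => ?_, fun j _ m => ?_⟩
      · have := h m hm j hj
        rwa [hann y m hm.le, hupd y m hm, Function.updateFinset, dif_neg hjJ] at this
      · have hm : (m : Fin r) < l := m.2
        have := h m hm j (remaining_anti s hm.le ((hJmem j).1 j.2))
        rwa [hann y m hm.le, hupd y m hm, Function.updateFinset, dif_pos j.2] at this
    · rintro ⟨hC, hD⟩ m hm j hj
      rw [hann y m hm.le, hupd y m hm, Function.updateFinset]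
      by_cases hjJ : j ∈ J
      · rw [dif_pos hjJ]
        exact hD ⟨j, hjJ⟩ trivial ⟨m, hm⟩
      · rw [dif_neg hjJ]
        exact hC m hm j hj hjJ
  have hRiff : ∀ y : J → EuclideanSpace ℂ (Fin r),
      Function.updateFinset x J y ∈ nondegenerate s l ↔ x ∈ nondegenerate s l := by
    intro y
    refine forall₂_congr fun m hm => ?_
    rw [hann y m hm.le, hupd y m hm]
  have hABiff : ∀ y : J → EuclideanSpace ℂ (Fin r),
      Function.updateFinset x J y ∈ greedyPrefix s l ∩ remainingGainLE s l t ↔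
        C ∧ y ∈ Set.pi univ fun _ => D' := by
    intro y
    rw [mem_inter_iff, hAiff y, and_assoc]
    refine and_congr_right fun _ => ?_
    constructor
    · rintro ⟨h1, h2⟩ j hj
      refine ⟨h1 j hj, ?_⟩
      have := h2 j ((hJmem j).1 j.2)
      rwa [hann y l le_rfl, Function.updateFinset, dif_pos j.2] at this
    · intro h
      refine ⟨fun j hj => (h j hj).1, fun j hj => ?_⟩
      have hjJ := (hJmem j).2 hj
      rw [hann y l le_rfl, Function.updateFinset, dif_pos hjJ]
      exact (h ⟨j, hjJ⟩ trivial).2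
  by_cases hCx : C ∧ x ∈ nondegenerate s l
  · obtain ⟨hC, hx⟩ := hCx
    have e1 : ∀ y : J → EuclideanSpace ℂ (Fin r),
        (greedyPrefix s l ∩ nondegenerate s l).indicator (fun _ => c)
          (Function.updateFinset x J y) =
        ((Function.updateFinset x J) ⁻¹' (greedyPrefix s l ∩ nondegenerate s l)).indicator
          (fun _ => c) y := fun y => rfl
    have e2 : ∀ y : J → EuclideanSpace ℂ (Fin r),
        (greedyPrefix s l ∩ remainingGainLE s l t).indicator (fun _ => (1 : ENNReal))
          (Function.updateFinset x J y) =
        ((Function.updateFinset x J) ⁻¹' (greedyPrefix s l ∩ remainingGainLE s l t)).indicator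
          (fun _ => 1) y := fun y => rfl
    simp_rw [e1, e2]
    rw [lintegral_indicator (measurable_updateFinset (hA.inter hR)), setLIntegral_const,
      lintegral_indicator (measurable_updateFinset (hA.inter hB)), setLIntegral_const, one_mul]
    have s1 : (Function.updateFinset x J) ⁻¹' (greedyPrefix s l ∩ nondegenerate s l) =
        Set.pi univ fun _ => D := by
      ext y
      rw [mem_preimage, mem_inter_iff, hAiff, hRiff]
      exact ⟨fun h => h.1.2, fun h => ⟨⟨hC, h⟩, hx⟩⟩
    have s2 : (Function.updateFinset x J) ⁻¹' (greedyPrefix s l ∩ remainingGainLE s l t) =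
        Set.pi univ fun _ => D' := by
      ext y
      rw [mem_preimage, hABiff]
      exact ⟨fun h => h.2, fun h => ⟨hC, h⟩⟩
    rw [s1, s2, Measure.pi_pi, Measure.pi_pi, Finset.prod_const, Finset.prod_const]
    have hcorr := hν.measure_zfGain_inter_ge (announced x s l)
      (fun m : Iio l => announced x s m) (fun m => announced_mono x s (le_of_lt m.2))
      (fun m => zfGain (announced x s m) (x (s m))) t
    rw [hν.measure_zfGain_le hv l.2 (finrank_span_announced hx) ht] at hcorr
    set n := (Finset.univ : Finset J).card
    have hnK : n ≤ K := by
      have h1 : n = J.card := by simp [n]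
      have h2 := J.card_le_univ
      simp only [Fintype.card_fin] at h2
      omega
    -- Only `n ≤ K` users remain, but `p ≤ 1`, so the exponent `K` gives a weaker bound that is
    -- uniform in the iteration.
    have hc : c ≤ ENNReal.ofReal p ^ n := by
      rw [← ENNReal.ofReal_pow hp0]
      exact ENNReal.ofReal_le_ofReal (pow_le_pow_of_le_one hp0 hp1 hnK)
    calc c * ν D ^ n ≤ ENNReal.ofReal p ^ n * ν D ^ n := by gcongr
      _ = (ν D * ENNReal.ofReal p) ^ n := by rw [mul_pow, mul_comm]
      _ ≤ ν D' ^ n := by gcongr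
  · refine le_trans (le_of_eq ?_) zero_le
    rw [lintegral_eq_zero_of_ae_eq_zero]
    refine ae_of_all _ fun y => indicator_of_notMem ?_ _
    rw [mem_inter_iff, hAiff, hRiff]
    exact fun h => hCx ⟨h.1.1, h.2⟩

end Configurations

/-! ### From independent components to independent isotropic vectors -/

section Channel

variable {Ω : Type*} [MeasurableSpace Ω] {μ : Measure Ω} {r K : ℕ} {v : NNReal}
  {h : Fin K → Ω → EuclideanSpace ℂ (Fin r)}

lemma IsGaussianChannel.aemeasurable (hh : IsGaussianChannel μ v h) :
    AEMeasurable (fun ω i => h i ω) μ := by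
  refine aemeasurable_pi_iff.2 fun i => ?_
  have e : h i = fun ω => WithLp.toLp 2 fun a =>
      ((component h (i, a, false) ω : ℂ) + (component h (i, a, true) ω : ℂ) * Complex.I) := by
    funext ω
    ext a
    simp [component, Complex.re_add_im]
  rw [e]
  have hm : AEMeasurable (fun ω => fun a =>
      ((component h (i, a, false) ω : ℂ) + (component h (i, a, true) ω : ℂ) * Complex.I)) μ := by
    refine aemeasurable_pi_iff.2 fun a => ?_
    have h1 := (hh.hasLaw (i, a, false)).aemeasurable
    have h2 := (hh.hasLaw (i, a, true)).aemeasurable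
    fun_prop
  exact (WithLp.measurable_toLp 2 _).comp_aemeasurable hm

/-- Independence factors the characteristic function over real components; regrouping by user gives
a product of isotropic factors. Both the law of each vector and the independence of the users follow
from it. -/
lemma IsGaussianChannel.integral_cexp (hh : IsGaussianChannel μ v h)
    (t : Fin K → EuclideanSpace ℂ (Fin r)) :
    ∫ ω, Complex.exp ((∑ i, inner ℝ (h i ω) (t i) : ℝ) * Complex.I) ∂μ =
      ∏ i, Complex.exp (-(((v : ℝ) : ℂ) * ‖t i‖ ^ 2 / 2)) := by
  let τ : Fin K × Fin r × Bool → ℝ := fun p =>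
    if p.2.2 then (t p.1 p.2.1).im else (t p.1 p.2.1).re
  have hlaw := hh.indep.hasLaw_pi hh.hasLaw
  have e1 : ∀ ω, ∑ i, inner ℝ (h i ω) (t i) = ∑ p, component h p ω * τ p := by
    intro ω
    rw [Fintype.sum_prod_type]
    refine Finset.sum_congr rfl fun i _ => ?_
    rw [Fintype.sum_prod_type, PiLp.inner_apply]
    refine Finset.sum_congr rfl fun a _ => ?_
    simp only [Fintype.sum_bool, component, τ, Complex.inner, if_true]
    simp [Complex.mul_re]
    ring
  have e2 : ∀ i, ‖t i‖ ^ 2 = ∑ q : Fin r × Bool, τ (i, q) ^ 2 := by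
    intro i
    rw [Fintype.sum_prod_type, EuclideanSpace.norm_sq_eq]
    refine Finset.sum_congr rfl fun a _ => ?_
    simp only [Fintype.sum_bool, τ, if_true]
    rw [Complex.sq_norm, Complex.normSq_apply]
    simp
    ring
  have e3 : ∀ c : Fin K × Fin r × Bool → ℝ,
      Complex.exp ((∑ p, c p * τ p : ℝ) * Complex.I) =
        ∏ p, Complex.exp (τ p * c p * Complex.I) := by
    intro c
    rw [← Complex.exp_sum]
    push_cast
    rw [Finset.sum_mul]
    congr 1
    exact Finset.sum_congr rfl fun p _ => by ring
  have e4 : ∫ ω, Complex.exp ((∑ i, inner ℝ (h i ω) (t i) : ℝ) * Complex.I) ∂μ =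
      ∫ c, ∏ p, Complex.exp (τ p * c p * Complex.I)
        ∂(Measure.pi fun _ : Fin K × Fin r × Bool => gaussianReal 0 v) := by
    simp_rw [e1]
    rw [← hlaw.map_eq, integral_map hlaw.aemeasurable (Continuous.aestronglyMeasurable (by fun_prop))]
    exact integral_congr_ae (ae_of_all _ fun ω => e3 fun p => component h p ω)
  rw [e4, integral_fintype_prod_eq_prod
    (f := fun (p : Fin K × Fin r × Bool) (y : ℝ) => Complex.exp (τ p * y * Complex.I))]
  simp_rw [← charFun_apply_real, charFun_gaussianReal]
  rw [← Complex.exp_sum, ← Complex.exp_sum, Fintype.sum_prod_type]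
  congr 1
  refine Finset.sum_congr rfl fun i _ => ?_
  have e5 : (‖t i‖ : ℂ) ^ 2 = ∑ q : Fin r × Bool, (τ (i, q) : ℂ) ^ 2 := by
    exact_mod_cast congrArg (fun y : ℝ => (y : ℂ)) (e2 i)
  rw [e5, Finset.mul_sum, Finset.sum_div, ← Finset.sum_neg_distrib]
  refine Finset.sum_congr rfl fun q _ => ?_
  push_cast
  ring

/-- The channel vectors are independent with a common isotropic Gaussian law. -/
lemma IsGaussianChannel.exists_map_eq_pi [IsProbabilityMeasure μ] (hh : IsGaussianChannel μ v h)
    (i₀ : Fin K) : ∃ ν : Measure (EuclideanSpace ℂ (Fin r)), IsProbabilityMeasure ν ∧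
      IsotropicGaussian (v : ℝ) ν ∧
        μ.map (fun ω i => h i ω) = Measure.pi fun _ : Fin K => ν := by
  have hm := hh.aemeasurable
  have hmi : ∀ i, AEMeasurable (h i) μ := fun i => aemeasurable_pi_iff.1 hm i
  have hν : IsotropicGaussian (v : ℝ) (μ.map (h i₀)) := by
    intro t
    rw [charFun_apply, integral_map (hmi i₀) (by fun_prop)]
    have := hh.integral_cexp (Pi.single i₀ t)
    rw [Finset.prod_eq_single i₀ (fun i _ hi => by simp [Pi.single_eq_of_ne hi]) (by simp),
      Pi.single_eq_same] at this
    rw [← this]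
    refine integral_congr_ae (ae_of_all _ fun ω => ?_)
    simp only
    rw [Finset.sum_eq_single i₀ (fun i _ hi => by simp [Pi.single_eq_of_ne hi]) (by simp),
      Pi.single_eq_same]
  refine ⟨μ.map (h i₀), Measure.isProbabilityMeasure_map (hmi i₀), hν, ?_⟩
  have := Measure.isProbabilityMeasure_map (μ := μ) hm
  have := Measure.isProbabilityMeasure_map (μ := μ) (hmi i₀)
  rw [← charFun_eq_pi_iff]
  intro t
  have hm2 : AEMeasurable (fun ω => WithLp.toLp 2 fun i => h i ω) μ :=
    (WithLp.measurable_toLp 2 _).comp_aemeasurable hm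
  rw [AEMeasurable.map_map_of_aemeasurable (by fun_prop) hm, Function.comp_def, charFun_apply,
    integral_map hm2 (by fun_prop)]
  simp_rw [hν _, PiLp.inner_apply]
  exact hh.integral_cexp t

end Channel

/-! ### Stochastic domination of the scheduled gain -/

section Transfer

variable {Ω : Type*} [MeasurableSpace Ω] {μ : Measure Ω} {r K : ℕ}
  {X : Ω → Fin K → EuclideanSpace ℂ (Fin r)} {sel : Ω → Fin r → Fin K}

/-- The gain of iteration `l` as a function of the schedule and the channel vectors. -/
noncomputable def selectedGain (l : Fin r)
    (p : (Fin r → Fin K) × (Fin K → EuclideanSpace ℂ (Fin r))) : ℝ :=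
  zfGain (announced p.2 p.1 l) (p.2 (p.1 l))

lemma measurable_selectedGain (l : Fin r) : Measurable (selectedGain (K := K) l) :=
  measurable_from_prod_countable_right fun s => measurable_zfGain_announced s l (s l)

lemma aemeasurable_zfGain (hX : AEMeasurable X μ) (hsel : Measurable sel) (l : Fin r) :
    AEMeasurable (fun ω => zfGain (announced (X ω) (sel ω) l) (X ω (sel ω l))) μ := by
  have h := (measurable_selectedGain l).comp_aemeasurable (hsel.aemeasurable.prodMk hX)
  simp only [Function.comp_def, selectedGain] at h
  exact h

/-- The gain of iteration `l` is stochastically dominated by the maximum of `K` independent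
Gamma variables of shape `r - l`. -/
lemma measure_zfGain_sel_le_ge [IsProbabilityMeasure μ] {v : ℝ} (hv : 0 < v)
    {ν : Measure (EuclideanSpace ℂ (Fin r))} [IsProbabilityMeasure ν]
    (hν : IsotropicGaussian v ν) (hX : AEMeasurable X μ)
    (hmap : μ.map X = Measure.pi fun _ : Fin K => ν) {u : Fin r → ℝ}
    (hrun : ∀ᵐ ω ∂μ, IsSICRun u (X ω) (sel ω)) (i₀ : Fin K) (l : Fin r) {t : ℝ} (ht : 0 ≤ t) :
    ENNReal.ofReal ((1 - poissonTail (r - l) (t / (2 * v))) ^ K) ≤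
      μ {ω | zfGain (announced (X ω) (sel ω) l) (X ω (sel ω l)) ≤ t} := by
  classical
  set c := ENNReal.ofReal ((1 - poissonTail (r - l) (t / (2 * v))) ^ K)
  -- Only the entries before `l` matter; filling the others with `i₀` gives each prefix a single
  -- representative in `T`.
  let tr : (Fin r → Fin K) → Fin r → Fin K := fun s m => if m < l then s m else i₀
  have htr : ∀ s, ∀ m < l, tr s m = s m := fun s m hm => if_pos hm
  let T : Finset (Fin r → Fin K) := Finset.univ.filter fun s =>
    (∀ m < l, s m ∈ remaining s m) ∧ tr s = s
  have hT : ∀ s ∈ T, (∀ m < l, s m ∈ remaining s m) ∧ tr s = s := fun s hs =>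
    (Finset.mem_filter.1 hs).2
  have hreg : ∀ᵐ ω ∂μ, X ω ∈ regularConfigs r K := by
    have := ae_mem_regularConfigs (K := K) hv hν
    rw [← hmap] at this
    exact ae_of_ae_map hX this
  have hAm := fun s => (measurableSet_greedyPrefix (r := r) (K := K) s l)
  have hBm := fun s => (measurableSet_remainingGainLE (r := r) (K := K) s l t)
  have hRm := fun s => (measurableSet_nondegenerate (r := r) (K := K) s l)
  have hpi : ∀ S : Set (Fin K → EuclideanSpace ℂ (Fin r)), MeasurableSet S →
      Measure.pi (fun _ : Fin K => ν) S = μ (X ⁻¹' S) := fun S hS => by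
    rw [← hmap, Measure.map_apply_of_aemeasurable hX hS]
  have hcover : ∀ᵐ ω ∂μ, ω ∈ ⋃ s ∈ T, X ⁻¹' (greedyPrefix s l ∩ nondegenerate s l) := by
    filter_upwards [hreg, hrun] with ω hω hr
    have hrem : ∀ m ≤ l, remaining (tr (sel ω)) m = remaining (sel ω) m := fun m hm =>
      remaining_congr fun k hk => htr _ k (hk.trans_le hm)
    have hann : ∀ m ≤ l, announced (X ω) (tr (sel ω)) m = announced (X ω) (sel ω) m :=
      fun m hm => announced_congr fun k hk => by rw [htr _ k (hk.trans_le hm)]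
    have hmem : ∀ m < l, tr (sel ω) m ∈ remaining (tr (sel ω)) m := by
      intro m hm
      rw [hrem m hm.le, htr _ m hm]
      exact (hr.isGreedy m).1
    refine mem_biUnion (x := tr (sel ω)) ?_ ⟨?_, ?_⟩
    · refine Finset.mem_coe.2 (Finset.mem_filter.2 ⟨Finset.mem_univ _, hmem, ?_⟩)
      funext m
      by_cases hm : m < l <;> simp [tr, hm]
    · intro m hm j hj
      rw [hrem m hm.le] at hj
      rw [hann m hm.le, htr _ m hm]
      exact (hr.isGreedy m).2 j hj
    · intro m hm
      exact (hω _ m _ (hmem m hm)).1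
  have huniq : ∀ᵐ ω ∂μ, ∀ s ∈ T, X ω ∈ greedyPrefix s l → s = tr (sel ω) := by
    filter_upwards [hreg, hrun] with ω hω hr s hs hA
    have h1 := hr.eq_of_mem_greedyPrefix hω (hT s hs).1 hA
    rw [← (hT s hs).2]
    funext m
    by_cases hm : m < l
    · simp only [tr, if_pos hm, h1 m hm]
    · simp only [tr, if_neg hm]
  -- The prefix events cover almost everything, so subadditivity suffices here; disjointness is
  -- needed only for the events on the larger side of the estimate.
  have hone : 1 ≤ ∑ s ∈ T, μ (X ⁻¹' (greedyPrefix s l ∩ nondegenerate s l)) := by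
    refine le_trans ?_ (measure_biUnion_finset_le T _)
    rw [← measure_univ (μ := μ)]
    exact measure_mono_ae (hcover.mono fun ω hω _ => hω)
  have hdisj : (T : Set (Fin r → Fin K)).Pairwise
      (Function.onFun (AEDisjoint μ) fun s => X ⁻¹' (greedyPrefix s l ∩ remainingGainLE s l t)) := by
    intro s hs s' hs' hne
    refine measure_mono_null (t := {ω | ¬ ∀ s ∈ T, X ω ∈ greedyPrefix s l → s = tr (sel ω)})
      (fun ω hω hall => hne ?_) huniq
    exact (hall s hs hω.1.1).trans (hall s' hs' hω.2.1).symm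
  have hsub : ∀ᵐ ω ∂μ, ω ∈ (⋃ s ∈ T, X ⁻¹' (greedyPrefix s l ∩ remainingGainLE s l t)) →
      ω ∈ {ω | zfGain (announced (X ω) (sel ω) l) (X ω (sel ω l)) ≤ t} := by
    filter_upwards [huniq, hrun] with ω hu hr hω
    obtain ⟨s, hs, hA, hB⟩ := mem_iUnion₂.1 hω
    have hse := hu s hs hA
    have hlt : ∀ m < l, s m = sel ω m := fun m hm => by rw [hse, htr _ m hm]
    have h1 := hB (sel ω l) (by rw [remaining_congr hlt]; exact (hr.isGreedy l).1)
    rwa [announced_congr (x' := X ω) (s' := sel ω) fun m hm => by rw [hlt m hm]] at h1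
  calc c = c * 1 := (mul_one c).symm
    _ ≤ c * ∑ s ∈ T, μ (X ⁻¹' (greedyPrefix s l ∩ nondegenerate s l)) := by gcongr
    _ = ∑ s ∈ T, c * μ (X ⁻¹' (greedyPrefix s l ∩ nondegenerate s l)) := Finset.mul_sum _ _ _
    _ ≤ ∑ s ∈ T, μ (X ⁻¹' (greedyPrefix s l ∩ remainingGainLE s l t)) := by
        refine Finset.sum_le_sum fun s _ => ?_
        rw [← hpi _ ((hAm s).inter (hRm s)), ← hpi _ ((hAm s).inter (hBm s))]
        exact measure_pi_greedyPrefix_mul_le hv hν s l ht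
    _ = μ (⋃ s ∈ T, X ⁻¹' (greedyPrefix s l ∩ remainingGainLE s l t)) :=
        (measure_biUnion_finset₀ hdisj fun s _ =>
          hX.nullMeasurableSet_preimage ((hAm s).inter (hBm s))).symm
    _ ≤ _ := measure_mono_ae hsub

end Transfer

/-! ### Assembly -/

lemma upperBound_eq (P : ℝ) (r K : ℕ) : upperBound P r K =
    ∑ l : Fin r, Real.log (1 + P * (bConst K (r - l)
      + Real.eulerMascheroniConstant * aConst K (r - l))) := by
  rw [upperBound, Fin.sum_univ_eq_sum_range (fun l => Real.log (1 + P * (bConst K (r - l)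
      + Real.eulerMascheroniConstant * aConst K (r - l)))) r]
  rw [Finset.range_eq_Ico, ← Finset.Ico_add_one_right_eq_Icc, Finset.sum_Ico_add'
    (fun l => Real.log (1 + P * (bConst K (r - l + 1)
      + Real.eulerMascheroniConstant * aConst K (r - l + 1)))) 0 r 1 |>.symm]
  refine Finset.sum_congr (by simp) fun l hl => ?_
  -- Iterations start at 0 here and at 1 in `upperBound`; the truncated subtraction is harmless
  -- because `l < r`.
  have : r - (l + 1) + 1 = r - l := by have := (Finset.mem_Ico.1 hl).2; omega
  rw [this]

lemma integrable_and_expectedSumCapacity_le {Ω : Type*} [MeasurableSpace Ω] {μ : Measure Ω}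
    {r K : ℕ} {P : ℝ} {h : Fin K → Ω → EuclideanSpace ℂ (Fin r)} {sel : Ω → Fin r → Fin K}
    (hl : ∀ l : Fin r,
      Integrable (fun ω => Real.log (1 + P *
        zfGain (announced (fun i => h i ω) (sel ω) l) (h (sel ω l) ω))) μ ∧
      ∫ ω, Real.log (1 + P *
        zfGain (announced (fun i => h i ω) (sel ω) l) (h (sel ω l) ω)) ∂μ ≤
        Real.log (1 + P * (bConst K (r - l)
          + Real.eulerMascheroniConstant * aConst K (r - l)))) :
    Integrable (fun ω => sumRate P (fun i => h i ω) (sel ω)) μ ∧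
      expectedSumCapacity μ P h sel ≤ upperBound P r K := by
  refine ⟨integrable_finsetSum _ fun l _ => (hl l).1, ?_⟩
  rw [upperBound_eq, expectedSumCapacity]
  simp only [sumRate]
  rw [integral_finsetSum _ fun l _ => (hl l).1]
  exact Finset.sum_le_sum fun l _ => (hl l).2

end SICAccess

theorem mainTheorem8 (r : ℕ) (hr : 1 ≤ r) (P : ℝ) (hP : 0 < P) :
    (∀ K : ℕ, r ≤ K →
      ∀ (Ω : Type*) [MeasurableSpace Ω] (μ : Measure Ω) [IsProbabilityMeasure μ]
        (h : Fin K → Ω → EuclideanSpace ℂ (Fin r)) (u : Fin r → ℝ) (sel : Ω → Fin r → Fin K),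
        SICAccess.IsGaussianChannel μ (1 / 2) h →
        Measurable sel →
        (∀ᵐ ω ∂μ, SICAccess.IsSICRun u (fun i => h i ω) (sel ω)) →
        Integrable (fun ω => SICAccess.sumRate P (fun i => h i ω) (sel ω)) μ ∧
          SICAccess.expectedSumCapacity μ P h sel ≤ SICAccess.upperBound P r K) ∧
    (∃ K₀ : ℕ, ∀ K : ℕ, K₀ ≤ K → r ≤ K →
      ∀ (Ω : Type*) [MeasurableSpace Ω] (μ : Measure Ω) [IsProbabilityMeasure μ]
        (h : Fin K → Ω → EuclideanSpace ℂ (Fin r)) (u : Fin r → ℝ) (sel : Ω → Fin r → Fin K),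
        SICAccess.IsGaussianChannel μ 1 h →
        Measurable sel →
        (∀ᵐ ω ∂μ, SICAccess.IsSICRun u (fun i => h i ω) (sel ω)) →
        Integrable (fun ω => SICAccess.sumRate P (fun i => h i ω) (sel ω)) μ ∧
          SICAccess.expectedSumCapacity μ P h sel ≤ SICAccess.upperBound P r K) := by
  -- Shapes are at most `r`, so `2 ^ (r + 19)` serves all iterations at once; the other entry is the
  -- condition involving `P`.
  refine ⟨?_, max (2 ^ (r + 19)) ⌈128 / P⌉₊, ?_⟩
  · intro K hK Ω _ μ _ h u sel hh hsel hrun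
    have i₀ : Fin K := ⟨0, by omega⟩
    obtain ⟨ν, _, hν, hmap⟩ := hh.exists_map_eq_pi i₀
    refine SICAccess.integrable_and_expectedSumCapacity_le fun l => ?_
    refine SICAccess.rate_le_of_dominated_half
      (SICAccess.aemeasurable_zfGain hh.aemeasurable hsel l)
      (fun ω => SICAccess.zfGain_nonneg _ _) (by omega) (by omega) (fun t ht => ?_) hP
    have := SICAccess.measure_zfGain_sel_le_ge (by simp) hν hh.aemeasurable hmap hrun i₀ l
      (t := 1 * t) (by linarith)
    -- For variance 1/2 the scale `2v` is 1.
    convert this using 5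
    simp
  · intro K hK₀ hK Ω _ μ _ h u sel hh hsel hrun
    have i₀ : Fin K := ⟨0, by omega⟩
    obtain ⟨ν, _, hν, hmap⟩ := hh.exists_map_eq_pi i₀
    refine SICAccess.integrable_and_expectedSumCapacity_le fun l => ?_
    have h1 : 2 ^ (r - (l : ℕ) + 19) ≤ K :=
      (Nat.pow_le_pow_right two_pos (by omega)).trans ((le_max_left _ _).trans hK₀)
    have h2 : 128 / P ≤ K :=
      (Nat.le_ceil _).trans (by exact_mod_cast (le_max_right _ _).trans hK₀)
    refine SICAccess.rate_le_of_dominated_one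
      (SICAccess.aemeasurable_zfGain hh.aemeasurable hsel l)
      (fun ω => SICAccess.zfGain_nonneg _ _) (by omega) (by omega) (fun t ht => ?_) hP h1 h2
    have := SICAccess.measure_zfGain_sel_le_ge (by simp) hν hh.aemeasurable hmap hrun i₀ l
      (t := 2 * t) (by linarith)
    -- For variance 1 the scale `2v` is 2 and cancels the factor in `2 * t`.
    convert this using 5
    simp
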